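/- **Theorem 1.** Work in Minkowski space $\mathbb R\times\mathbb R^d$ with $c=1$; the future light cone of $p$ is the solid cone of all $q$ with $q-p=(t,x)$, $t\ge |x|$, and the past light cone is defined likewise. A summoning task consists of a start point $s$, call points $y_0,\dots,y_{n-1}$, and for each $j$ a reveal point $z_j$ in the future light cone of $y_j$. Its causal diamonds are the sets $D_j$ of points lying in the future light cone of $y_j$ and in the past light cone of $z_j$. A quantum system of finite dimension $k\ge 2$ (e.g. a qubit) in an unknown pure state $|\varphi\rangle$ is given at $s$. At most one of the call points receives a request, and it is not known in advance which. A protocol uses finitely many finite-dimensional quantum systems: the input system, an output register of dimension $k$ for each $j$, and auxiliary systems. All systems other than the input start in a fixed product state. The protocol is a finite sequence of steps; in each step some of the systems are brought together at a spacetime point $p$, where a quantum operation (completely positive trace-preserving map) is applied to them instantaneously. The operation may depend on the calls received at those $y_j$ that have $p$ in their future light cone. A system can take part in two successive steps only if the later point lies in the future light cone of the earlier one; the input system is used only in the future light cone of $s$; the $j$-th output register is used only in the past light cone of $z_j$, where it is handed over. Summoning is *possible* if some protocol has the property that, for every $j$ and every $|\varphi\rangle$, if the only request is received at $y_j$, then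 the final state of the $j$-th output register is exactly $|\varphi\rangle\langle\varphi|$. Summoning is possible if and only if the following two conditions hold: 1. every reveal point $z_j$ lies in the future light cone of $s$; 2. for each pair $(i,j)$ the diamonds $D_i$ and $D_j$ are causally related, meaning that there is a causal curve (a differentiable curve with future-directed timelike or lightlike, possibly zero, velocity) from a point of $D_i$ to a point of $D_j$ or vice versa. -/

import Mathlib

namespace Summoning

/-! Minkowski space and its causal structure (units in which the speed of light is one). -/

/-- Minkowski space with `d` space dimensions: a point is a pair (time, position). -/
abbrev Minkowski (d : ℕ) : Type := ℝ × EuclideanSpace ℝ (Fin d)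

/-- The Minkowski square of a vector, with signature `(+, -, ..., -)`. -/
noncomputable def interval {d : ℕ} (v : Minkowski d) : ℝ := v.1 ^ 2 - ‖v.2‖ ^ 2

/-- A vector is future-directed causal if it is timelike or lightlike and does not point to the
past. The zero vector is admitted. -/
def IsFutureCausal {d : ℕ} (v : Minkowski d) : Prop := 0 ≤ v.1 ∧ 0 ≤ interval v

/-- The (solid) future light cone of `p`: all points that a signal from `p` can reach. -/
def futureCone {d : ℕ} (p : Minkowski d) : Set (Minkowski d) := {q | IsFutureCausal (q - p)}

/-- The (solid) past light cone of `p`: all points from which a signal can reach `p`. -/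
def pastCone {d : ℕ} (p : Minkowski d) : Set (Minkowski d) := {q | IsFutureCausal (p - q)}

/-- `γ`, restricted to `[0, 1]`, is a causal curve from `p` to `q`: a differentiable curve all of
whose velocities are future-directed causal. A constant curve is a (degenerate) causal curve. -/
def IsCausalCurve {d : ℕ} (γ : ℝ → Minkowski d) (p q : Minkowski d) : Prop :=
  γ 0 = p ∧ γ 1 = q ∧ ∀ t ∈ Set.Icc (0 : ℝ) 1, ∃ v : Minkowski d,
    HasDerivWithinAt γ v (Set.Icc 0 1) t ∧ IsFutureCausal v

/-- There is a causal curve from some point of `A` to some point of `B`. -/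
def CausalCurveBetween {d : ℕ} (A B : Set (Minkowski d)) : Prop :=
  ∃ p ∈ A, ∃ q ∈ B, ∃ γ : ℝ → Minkowski d, IsCausalCurve γ p q

/-- Two regions are causally related if a causal curve runs from one of them to the other. -/
def CausallyRelated {d : ℕ} (A B : Set (Minkowski d)) : Prop :=
  CausalCurveBetween A B ∨ CausalCurveBetween B A

/-- The data of a summoning task with `n` call points in Minkowski space: the start point, the
call points, and for each call point a reveal point in its future light cone. -/
structure SummoningTask (d n : ℕ) where
  start : Minkowski d
  call : Fin n → Minkowski d
  reveal : Fin n → Minkowski d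
  reveal_mem : ∀ j, reveal j ∈ futureCone (call j)

/-- The causal diamond of the `j`-th call-reveal pair. -/
def SummoningTask.diamond {d n : ℕ} (T : SummoningTask d n) (j : Fin n) : Set (Minkowski d) :=
  futureCone (T.call j) ∩ pastCone (T.reveal j)

/-! Finite-dimensional quantum mechanics of a finite family `C` of systems ("carriers"), the
carrier `c` having the Hilbert space with orthonormal basis `Fin (dim c)`. -/

/-- The labels of the product basis of the Hilbert space of all carriers. -/
abbrev Config {C : Type} (dim : C → ℕ) : Type := (c : C) → Fin (dim c)

/-- The labels of the product basis of the Hilbert space of the carriers in `S`. -/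
abbrev SubConfig {C : Type} (dim : C → ℕ) (S : Finset C) : Type := (c : S) → Fin (dim c)

/-- A quantum operation (completely positive trace-preserving map), given by Kraus operators. -/
structure QuantumOp (X : Type) [Fintype X] [DecidableEq X] where
  rank : ℕ
  kraus : Fin rank → Matrix X X ℂ
  complete : ∑ i, (kraus i).conjTranspose * kraus i = 1

/-- The rank-one operator `|ψ⟩⟨ψ|`. -/
def ketBra {X : Type} (ψ : X → ℂ) : Matrix X X ℂ := Matrix.vecMulVec ψ (star ψ)

/-- The operator `K ⊗ 1` on all carriers, for an operator `K` on the carriers in `S`. -/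
def extendOp {C : Type} [Fintype C] [DecidableEq C] {dim : C → ℕ} (S : Finset C)
    (K : Matrix (SubConfig dim S) (SubConfig dim S) ℂ) :
    Matrix (Config dim) (Config dim) ℂ :=
  fun b b' => if ∀ c, c ∉ S → b c = b' c then K (S.restrict b) (S.restrict b') else 0

/-- The action on a state of all carriers of a quantum operation on the carriers in `S`. -/
def applyOn {C : Type} [Fintype C] [DecidableEq C] {dim : C → ℕ} (S : Finset C)
    (Φ : QuantumOp (SubConfig dim S)) (ρ : Matrix (Config dim) (Config dim) ℂ) :
    Matrix (Config dim) (Config dim) ℂ :=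
  ∑ i, extendOp S (Φ.kraus i) * ρ * (extendOp S (Φ.kraus i)).conjTranspose

/-- The reduced state of the carrier `c` (partial trace over all the other carriers). -/
def reducedState {C : Type} [Fintype C] [DecidableEq C] {dim : C → ℕ} (c : C)
    (ρ : Matrix (Config dim) (Config dim) ℂ) : Matrix (Fin (dim c)) (Fin (dim c)) ℂ :=
  fun a a' => ∑ b : Config dim, if b c = a then ρ b (Function.update b c a') else 0

/-! Summoning protocols. -/

/-- The carriers of a protocol: the system that holds the unknown state at the start point, for
each reveal point a register that is handed over there, and auxiliary systems. -/
abbrev Carrier (n : ℕ) (Aux : Type) : Type := Unit ⊕ (Fin n ⊕ Aux)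

/-- The system that holds the unknown state at the start point. -/
abbrev Carrier.input {n : ℕ} {Aux : Type} : Carrier n Aux := Sum.inl ()

/-- The register that is handed over at the `j`-th reveal point. -/
abbrev Carrier.output {n : ℕ} {Aux : Type} (j : Fin n) : Carrier n Aux := Sum.inr (Sum.inl j)

/-- Dimensions: `k` for the input system and the output registers, arbitrary for the others. -/
abbrev Carrier.dim {n : ℕ} {Aux : Type} (k : ℕ) (auxDim : Aux → ℕ) : Carrier n Aux → ℕ
  | Sum.inl _ => k
  | Sum.inr (Sum.inl _) => k
  | Sum.inr (Sum.inr a) => auxDim a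

/-- One step of a protocol: at the spacetime point `point`, the carriers in `carriers` are brought
together and an instantaneous quantum operation is applied to them, which may depend on the set of
calls whose occurrence is known at `point`. -/
structure Step (d n : ℕ) {C : Type} [Fintype C] [DecidableEq C] (dim : C → ℕ) where
  point : Minkowski d
  carriers : Finset C
  op : Set (Fin n) → QuantumOp (SubConfig dim carriers)

/-- If calls are received exactly at the call points with index in `J`, these are the calls that
can be known at the point `p`. -/
def SummoningTask.heard {d n : ℕ} (T : SummoningTask d n) (J : Set (Fin n)) (p : Minkowski d) :
    Set (Fin n) :=
  {j | j ∈ J ∧ p ∈ futureCone (T.call j)}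

/-- A protocol for a summoning task with a `k`-dimensional system. Initially all carriers other
than the input are in fixed basis states; shared entanglement has to be produced by steps. -/
structure Protocol {d n : ℕ} (T : SummoningTask d n) (k : ℕ) where
  Aux : Type
  [fintypeAux : Fintype Aux]
  [decEqAux : DecidableEq Aux]
  auxDim : Aux → ℕ
  /-- The initial basis states; the entry for the input carrier plays no role. -/
  ready : Config (Carrier.dim (n := n) k auxDim)
  /-- The steps, listed in an order in which they can be applied. -/
  steps : List (Step d n (Carrier.dim (n := n) k auxDim))
  /-- A carrier takes part in a later step only in the future light cone of an earlier one. -/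
  steps_causal : steps.Pairwise fun a b =>
    (a.carriers ∩ b.carriers).Nonempty → b.point ∈ futureCone a.point
  /-- The input system is available only in the future light cone of the start point. -/
  input_causal : ∀ a ∈ steps, Carrier.input ∈ a.carriers → a.point ∈ futureCone T.start
  /-- After each step in which it takes part, the `j`-th register can reach the reveal point. -/
  output_causal : ∀ a ∈ steps, ∀ j : Fin n, Carrier.output j ∈ a.carriers →
    T.reveal j ∈ futureCone a.point

attribute [instance] Protocol.fintypeAux Protocol.decEqAux

/-- Operators on the Hilbert space of all carriers of the protocol. -/
abbrev Protocol.Operator {d n : ℕ} {T : SummoningTask d n} {k : ℕ} (P : Protocol T k) : Type :=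
  Matrix (Config (Carrier.dim (n := n) k P.auxDim)) (Config (Carrier.dim (n := n) k P.auxDim)) ℂ

/-- The initial state of all carriers when the unknown state is `φ`. -/
noncomputable def Protocol.initialState {d n : ℕ} {T : SummoningTask d n} {k : ℕ}
    (P : Protocol T k) (φ : Fin k → ℂ) : P.Operator :=
  ketBra fun b => if ∀ c, c ≠ Carrier.input → b c = P.ready c then φ (b Carrier.input) else 0

/-- The state of all carriers at the end, when calls are received exactly at the call points with
index in `J` and the unknown state is `φ`. -/
noncomputable def Protocol.finalState {d n : ℕ} {T : SummoningTask d n} {k : ℕ}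
    (P : Protocol T k) (J : Set (Fin n)) (φ : Fin k → ℂ) : P.Operator :=
  P.steps.foldl (fun ρ a => applyOn a.carriers (a.op (T.heard J a.point)) ρ) (P.initialState φ)

/-- The state of the register that is handed over at the `j`-th reveal point. -/
noncomputable def Protocol.revealed {d n : ℕ} {T : SummoningTask d n} {k : ℕ}
    (P : Protocol T k) (J : Set (Fin n)) (φ : Fin k → ℂ) (j : Fin n) :
    Matrix (Fin k) (Fin k) ℂ :=
  reducedState (Carrier.output j) (P.finalState J φ)

/-- The protocol is successful: whenever a single call is received, at the `j`-th call point, the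
unknown state is revealed at the `j`-th reveal point. -/
def Protocol.Succeeds {d n : ℕ} {T : SummoningTask d n} {k : ℕ} (P : Protocol T k) : Prop :=
  ∀ (j : Fin n) (φ : Fin k → ℂ), ∑ i, ‖φ i‖ ^ 2 = 1 → P.revealed {j} φ j = ketBra φ

/-- Summoning a `k`-dimensional quantum system is possible for the task `T`. -/
def SummoningTask.IsPossible {d n : ℕ} (T : SummoningTask d n) (k : ℕ) : Prop :=
  ∃ P : Protocol T k, P.Succeeds

end Summoning

open Summoning

namespace Summoning

/-! Causal structure of Minkowski space. -/

/-! Write `s` for the start, `y i` for the calls and `z i` for the reveals. A causal curve runs from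
`D i` to `D j` exactly if `z j` is in the future of `y i` (`causalCurveBetween_iff`), so condition 2
says that for each pair at least one of the two call points can reach the other's reveal point.

Necessity. An observable of the `j`-th register is pulled back through the protocol. Steps off its
support drop out, and the others lie in the past of `z j` (`exists_heisenberg`). So the revealed
state depends only on calls in the past of `z j`, and it does not depend on `φ` if `z j` is outside
the future of `s`. If `D i` and `D j` are unrelated, let both calls occur: neither reveal point
notices the other call, so both registers end in `φ`, against `no_cloning`.

Sufficiency. Over the integers mod `k`, a label `h` is encoded as the uniform superposition of pair
labels `p i l = p l i` together with register labels `x i = h - ∑ l ≠ i, p i l`. From `x j` and all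
`p j l` one recovers `h`; shifting each `p j l` by `-h` then removes `h` from the rest, so decoding
at `z j` leaves a product state. The label `p i l` passes through a call point that can reach both
`z i` and `z l`; if that is `y i`, it goes on to `z l` unless the call is at `y i`. Whichever `j` is
called, all `p j l` thus meet at `z j`.

The call points need not lie in the future of `s`. So the code is prepared in a common past,
entangled with `half`, and `φ` is teleported into it at `s`. By condition 1 the outcome can be sent
to every `z j`, where its shift and phase are undone. No measurement is made: outcomes are copied
coherently, so after the preparation everything is a calculation with state vectors
(`exists_product_form`). -/

theorem isFutureCausal_iff {d : ℕ} (v : Minkowski d) : IsFutureCausal v ↔ ‖v.2‖ ≤ v.1 := by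
  unfold IsFutureCausal interval
  constructor
  · rintro ⟨h0, h1⟩
    nlinarith [norm_nonneg v.2]
  · intro h
    have h0 : 0 ≤ v.1 := (norm_nonneg _).trans h
    refine ⟨h0, ?_⟩
    have := pow_le_pow_left₀ (norm_nonneg v.2) h 2
    linarith

theorem mem_futureCone_iff {d : ℕ} {p q : Minkowski d} :
    q ∈ futureCone p ↔ ‖q.2 - p.2‖ ≤ q.1 - p.1 := by
  simp [futureCone, isFutureCausal_iff]

theorem self_mem_futureCone {d : ℕ} (p : Minkowski d) : p ∈ futureCone p := by
  simp [mem_futureCone_iff]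

theorem futureCone_trans {d : ℕ} {p q r : Minkowski d} (hpq : q ∈ futureCone p)
    (hqr : r ∈ futureCone q) : r ∈ futureCone p := by
  rw [mem_futureCone_iff] at *
  calc ‖r.2 - p.2‖ = ‖(r.2 - q.2) + (q.2 - p.2)‖ := by congr 1; abel
    _ ≤ ‖r.2 - q.2‖ + ‖q.2 - p.2‖ := norm_add_le _ _
    _ ≤ r.1 - p.1 := by linarith

/-- The velocity condition bounds the norm of the spatial derivative by the time derivative; the
mean value inequality, with elapsed time as the bounding function, integrates this. -/
theorem IsCausalCurve.mem_futureCone {d : ℕ} {γ : ℝ → Minkowski d} {p q : Minkowski d}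
    (h : IsCausalCurve γ p q) : q ∈ futureCone p := by
  obtain ⟨h0, h1, hv⟩ := h
  choose! v hγ hcausal using hv
  have h1' : ∀ t ∈ Set.Icc (0 : ℝ) 1,
      HasDerivWithinAt (fun t => (γ t).1 - p.1) (v t).1 (Set.Icc 0 1) t := fun t ht =>
    ((ContinuousLinearMap.fst ℝ ℝ (EuclideanSpace ℝ (Fin d))).hasFDerivAt.comp_hasDerivWithinAt t
      (hγ t ht)).sub_const p.1
  have h2' : ∀ t ∈ Set.Icc (0 : ℝ) 1,
      HasDerivWithinAt (fun t => (γ t).2 - p.2) (v t).2 (Set.Icc 0 1) t := fun t ht =>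
    ((ContinuousLinearMap.snd ℝ ℝ (EuclideanSpace ℝ (Fin d))).hasFDerivAt.comp_hasDerivWithinAt t
      (hγ t ht)).sub_const p.2
  have hright : ∀ t ∈ Set.Ico (0 : ℝ) 1, Set.Icc (0 : ℝ) 1 ∈ nhdsWithin t (Set.Ici t) :=
    fun t ht => Filter.mem_of_superset (Icc_mem_nhdsGE ht.2)
      (Set.Icc_subset_Icc_left ht.1)
  have key := image_norm_le_of_norm_deriv_right_le_deriv_boundary'
    (f := fun t => (γ t).2 - p.2) (f' := fun t => (v t).2)
    (B := fun t => (γ t).1 - p.1) (B' := fun t => (v t).1) (a := 0) (b := 1)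
    (fun t ht => (h2' t ht).continuousWithinAt)
    (fun t ht => (h2' t (Set.Ico_subset_Icc_self ht)).mono_of_mem_nhdsWithin (hright t ht))
    (by simp [h0])
    (fun t ht => (h1' t ht).continuousWithinAt)
    (fun t ht => (h1' t (Set.Ico_subset_Icc_self ht)).mono_of_mem_nhdsWithin (hright t ht))
    (fun t ht => (isFutureCausal_iff _).1 (hcausal t (Set.Ico_subset_Icc_self ht)))
    (Set.right_mem_Icc.2 zero_le_one)
  rw [mem_futureCone_iff, ← h1]
  exact key

theorem isCausalCurve_segment {d : ℕ} {p q : Minkowski d} (h : q ∈ futureCone p) :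
    IsCausalCurve (fun t : ℝ => p + t • (q - p)) p q := by
  refine ⟨by simp, by simp, fun t _ => ⟨q - p, ?_, h⟩⟩
  have := ((hasDerivAt_id t).smul_const (q - p)).const_add p
  simpa using this.hasDerivWithinAt

/-- The tips decide: the call point precedes its whole diamond and the reveal point follows it. -/
theorem SummoningTask.causalCurveBetween_iff {d n : ℕ} (T : SummoningTask d n) (i j : Fin n) :
    CausalCurveBetween (T.diamond i) (T.diamond j) ↔ T.reveal j ∈ futureCone (T.call i) := by
  constructor
  · rintro ⟨p, hp, q, hq, γ, hγ⟩
    exact futureCone_trans hp.1 (futureCone_trans hγ.mem_futureCone hq.2)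
  · intro h
    exact ⟨T.call i, ⟨self_mem_futureCone _, T.reveal_mem i⟩, T.reveal j,
      ⟨T.reveal_mem j, self_mem_futureCone _⟩, _, isCausalCurve_segment h⟩

theorem SummoningTask.causallyRelated_iff {d n : ℕ} (T : SummoningTask d n) (i j : Fin n) :
    CausallyRelated (T.diamond i) (T.diamond j) ↔
      T.reveal j ∈ futureCone (T.call i) ∨ T.reveal i ∈ futureCone (T.call j) := by
  simp only [CausallyRelated, T.causalCurveBetween_iff]

/-- Finitely many points have a common past. -/
theorem exists_common_past {d : ℕ} (s : Finset (Minkowski d)) :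
    ∃ p : Minkowski d, ∀ q ∈ s, q ∈ futureCone p := by
  induction s using Finset.induction_on with
  | empty => exact ⟨0, by simp⟩
  | insert q s _ ih =>
    obtain ⟨p, hp⟩ := ih
    have hpast : ∀ r : Minkowski d, r = p ∨ r = q →
        r ∈ futureCone ((min p.1 q.1 - ‖q.2 - p.2‖, p.2) : Minkowski d) := by
      rintro r (rfl | rfl) <;> rw [mem_futureCone_iff]
      · have := min_le_left r.1 q.1
        simp only [sub_self, norm_zero]
        linarith [norm_nonneg (q.2 - r.2)]
      · have := min_le_right p.1 r.1
        simp only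
        linarith
    refine ⟨(min p.1 q.1 - ‖q.2 - p.2‖, p.2), fun r hr => ?_⟩
    rcases Finset.mem_insert.1 hr with rfl | hr
    · exact hpast _ (Or.inr rfl)
    · exact futureCone_trans (hpast p (Or.inl rfl)) (hp r hr)

/-! Operators acting on part of the carriers. -/

section Operators

variable {C : Type} [DecidableEq C] {dim : C → ℕ}

/-- The configuration that agrees with `y` on `S` and with `b` elsewhere. -/
def glue (S : Finset C) (b : Config dim) (y : SubConfig dim S) : Config dim :=
  fun c => if h : c ∈ S then y ⟨c, h⟩ else b c

@[simp] theorem glue_apply_not_mem {S : Finset C} {b : Config dim} {y : SubConfig dim S} {c : C}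
    (h : c ∉ S) : glue S b y c = b c := by simp [glue, h]

@[simp] theorem glue_apply_mem {S : Finset C} {b : Config dim} {y : SubConfig dim S} {c : C}
    (h : c ∈ S) : glue S b y c = y ⟨c, h⟩ := by simp [glue, h]

@[simp] theorem restrict_glue (S : Finset C) (b : Config dim) (y : SubConfig dim S) :
    S.restrict (glue S b y) = y := by
  funext ⟨c, hc⟩
  simp [hc]

theorem glue_restrict_of_agree {S : Finset C} {b b' : Config dim} (h : ∀ c, c ∉ S → b c = b' c) :
    glue S b (S.restrict b') = b' := by
  funext c
  by_cases hc : c ∈ S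
  · simp [hc]
  · simp [hc, h c hc]

omit [DecidableEq C] in
theorem restrict_eq_iff {S : Finset C} {b b' : Config dim} :
    S.restrict b = S.restrict b' ↔ ∀ c ∈ S, b c = b' c := by
  simp [funext_iff]

variable [Fintype C]

theorem sum_agree (S : Finset C) {M : Type*} [AddCommMonoid M] (b : Config dim)
    (f : Config dim → M) :
    ∑ b' : Config dim, (if ∀ c, c ∉ S → b c = b' c then f b' else 0) =
      ∑ y : SubConfig dim S, f (glue S b y) := by
  rw [← Finset.sum_filter]
  refine Finset.sum_bij' (fun b' _ => S.restrict b') (fun y _ => glue S b y) ?_ ?_ ?_ ?_ ?_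
  · simp
  · intro y _
    simp +contextual
  · intro b' hb'
    exact glue_restrict_of_agree (Finset.mem_filter.1 hb').2
  · simp
  · intro b' hb'
    rw [glue_restrict_of_agree (Finset.mem_filter.1 hb').2]

theorem extendOp_mul_apply (S : Finset C) (K : Matrix (SubConfig dim S) (SubConfig dim S) ℂ)
    (M : Matrix (Config dim) (Config dim) ℂ) (b b' : Config dim) :
    (extendOp S K * M) b b' = ∑ y, K (S.restrict b) y * M (glue S b y) b' := by
  rw [Matrix.mul_apply]
  simp only [extendOp, ite_mul, zero_mul]
  rw [sum_agree S b fun b₁ => K (S.restrict b) (S.restrict b₁) * M b₁ b']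
  simp

theorem extendOp_mul (S : Finset C) (K L : Matrix (SubConfig dim S) (SubConfig dim S) ℂ) :
    extendOp S (K * L) = extendOp S K * extendOp S L := by
  ext b b'
  rw [extendOp_mul_apply]
  simp only [extendOp, restrict_glue, Matrix.mul_apply]
  by_cases h : ∀ c, c ∉ S → b c = b' c
  · rw [if_pos h]
    refine Finset.sum_congr rfl fun y _ => ?_
    rw [if_pos fun c hc => by simpa [hc] using h c hc]
  · rw [if_neg h]
    refine (Finset.sum_eq_zero fun y _ => ?_).symm
    rw [if_neg fun h' => h fun c hc => by simpa [hc] using h' c hc, mul_zero]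

theorem extendOp_one (S : Finset C) :
    extendOp S (1 : Matrix (SubConfig dim S) (SubConfig dim S) ℂ) = 1 := by
  ext b b'
  simp only [extendOp, Matrix.one_apply, ← ite_and, restrict_eq_iff]
  congr 1
  refine propext ⟨fun h => funext fun c => ?_, by rintro rfl; simp⟩
  by_cases hc : c ∈ S
  exacts [h.2 c hc, h.1 c hc]

theorem extendOp_conjTranspose (S : Finset C)
    (K : Matrix (SubConfig dim S) (SubConfig dim S) ℂ) :
    extendOp S K.conjTranspose = (extendOp S K).conjTranspose := by
  ext b b'
  simp only [extendOp, Matrix.conjTranspose_apply, apply_ite star, star_zero, eq_comm]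

theorem extendOp_sum (S : Finset C) {ι : Type*} (s : Finset ι)
    (K : ι → Matrix (SubConfig dim S) (SubConfig dim S) ℂ) :
    extendOp S (∑ i ∈ s, K i) = ∑ i ∈ s, extendOp S (K i) := by
  ext b b'
  simp only [extendOp, Matrix.sum_apply]
  split_ifs <;> simp

theorem extendOp_mul_extendOp_apply {S U : Finset C} (h : Disjoint S U)
    (K : Matrix (SubConfig dim S) (SubConfig dim S) ℂ)
    (L : Matrix (SubConfig dim U) (SubConfig dim U) ℂ) (b b' : Config dim) :
    (extendOp S K * extendOp U L) b b' =
      if ∀ c, c ∉ S → c ∉ U → b c = b' c then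
        K (S.restrict b) (S.restrict b') * L (U.restrict b) (U.restrict b') else 0 := by
  -- An intermediate configuration agrees with `b'` off `U`, hence on `S`; only one survives, and
  -- the product is a tensor product.
  rw [extendOp_mul_apply, Finset.sum_eq_single (S.restrict b')]
  · have h1 : U.restrict (glue S b (S.restrict b')) = U.restrict b :=
      restrict_eq_iff.2 fun c hc => glue_apply_not_mem (Finset.disjoint_right.1 h hc)
    simp only [extendOp, h1, mul_ite, mul_zero]
    congr 1
    refine propext (forall_congr' fun c => ?_)
    by_cases hc : c ∈ S <;> simp [hc]
  · intro y _ hy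
    simp only [extendOp]
    rw [if_neg, mul_zero]
    intro h'
    refine hy (funext fun ⟨c, hc⟩ => ?_)
    simpa [hc] using h' c (Finset.disjoint_left.1 h hc)
  · simp

theorem extendOp_commute {S U : Finset C} (h : Disjoint S U)
    (K : Matrix (SubConfig dim S) (SubConfig dim S) ℂ)
    (L : Matrix (SubConfig dim U) (SubConfig dim U) ℂ) :
    Commute (extendOp S K) (extendOp U L) := by
  ext b b'
  rw [extendOp_mul_extendOp_apply h, extendOp_mul_extendOp_apply h.symm]
  simp only [mul_comm]
  congr 1
  exact propext (forall_congr' fun c => ⟨fun h h1 h2 => h h2 h1, fun h h1 h2 => h h2 h1⟩)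

theorem QuantumOp.sum_extendOp {S : Finset C} (Φ : QuantumOp (SubConfig dim S)) :
    ∑ i, (extendOp S (Φ.kraus i)).conjTranspose * extendOp S (Φ.kraus i) = 1 := by
  simp only [← extendOp_conjTranspose, ← extendOp_mul]
  rw [← extendOp_sum, Φ.complete, extendOp_one]

/-- The action on an observable of the adjoint of a quantum operation. -/
def pullback (S : Finset C) (Φ : QuantumOp (SubConfig dim S))
    (A : Matrix (Config dim) (Config dim) ℂ) : Matrix (Config dim) (Config dim) ℂ :=
  ∑ i, (extendOp S (Φ.kraus i)).conjTranspose * A * extendOp S (Φ.kraus i)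

theorem trace_mul_applyOn (S : Finset C) (Φ : QuantumOp (SubConfig dim S))
    (A ρ : Matrix (Config dim) (Config dim) ℂ) :
    (A * applyOn S Φ ρ).trace = (pullback S Φ A * ρ).trace := by
  simp only [applyOn, pullback, Finset.mul_sum, Finset.sum_mul, Matrix.trace_sum]
  refine Finset.sum_congr rfl fun i _ => ?_
  rw [← Matrix.mul_assoc, Matrix.trace_mul_comm]
  simp only [Matrix.mul_assoc]

theorem trace_applyOn (S : Finset C) (Φ : QuantumOp (SubConfig dim S))
    (ρ : Matrix (Config dim) (Config dim) ℂ) : (applyOn S Φ ρ).trace = ρ.trace := by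
  have h := trace_mul_applyOn S Φ 1 ρ
  simpa [pullback, Φ.sum_extendOp] using h

/-- An operator is local to `S` if it commutes with the operators on the other carriers. -/
def IsLocalTo (S : Finset C) (A : Matrix (Config dim) (Config dim) ℂ) : Prop :=
  ∀ U : Finset C, Disjoint U S → ∀ K : Matrix (SubConfig dim U) (SubConfig dim U) ℂ,
    Commute A (extendOp U K)

theorem isLocalTo_extendOp (S : Finset C) (K : Matrix (SubConfig dim S) (SubConfig dim S) ℂ) :
    IsLocalTo S (extendOp S K) :=
  fun _ hU L => extendOp_commute hU.symm K L

theorem IsLocalTo.mono {S S' : Finset C} (h : S ⊆ S') {A : Matrix (Config dim) (Config dim) ℂ}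
    (hA : IsLocalTo S A) : IsLocalTo S' A :=
  fun U hU K => hA U (hU.mono_right h) K

theorem IsLocalTo.mul {S : Finset C} {A B : Matrix (Config dim) (Config dim) ℂ}
    (hA : IsLocalTo S A) (hB : IsLocalTo S B) : IsLocalTo S (A * B) :=
  fun U hU K => (hA U hU K).mul_left (hB U hU K)

theorem IsLocalTo.sum {S : Finset C} {ι : Type*} {s : Finset ι}
    {A : ι → Matrix (Config dim) (Config dim) ℂ} (hA : ∀ i ∈ s, IsLocalTo S (A i)) :
    IsLocalTo S (∑ i ∈ s, A i) :=
  fun U hU K => Commute.sum_left _ _ _ fun i hi => hA i hi U hU K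

theorem IsLocalTo.pullback {S U : Finset C} {A : Matrix (Config dim) (Config dim) ℂ}
    (hA : IsLocalTo U A) (Φ : QuantumOp (SubConfig dim S)) :
    IsLocalTo (U ∪ S) (pullback S Φ A) := by
  refine IsLocalTo.sum fun i _ => ((IsLocalTo.mul ?_ ?_).mul ?_)
  · rw [← extendOp_conjTranspose]
    exact (isLocalTo_extendOp S _).mono Finset.subset_union_right
  · exact hA.mono Finset.subset_union_left
  · exact (isLocalTo_extendOp S _).mono Finset.subset_union_right

/-- No-signalling: the observable commutes past the Kraus operators, which the completeness relation
then removes. -/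
theorem IsLocalTo.pullback_of_disjoint {S U : Finset C} {A : Matrix (Config dim) (Config dim) ℂ}
    (hA : IsLocalTo U A) (h : Disjoint S U) (Φ : QuantumOp (SubConfig dim S)) :
    Summoning.pullback S Φ A = A := by
  have key : ∀ i, (extendOp S (Φ.kraus i)).conjTranspose * A * extendOp S (Φ.kraus i) =
      (extendOp S (Φ.kraus i)).conjTranspose * extendOp S (Φ.kraus i) * A := fun i => by
    rw [Matrix.mul_assoc, (hA S h _).eq, Matrix.mul_assoc]
  simp only [Summoning.pullback, key]
  rw [← Finset.sum_mul, Φ.sum_extendOp, one_mul]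

/-- Entries of a reduced state, as a sum over the configurations with a fixed label `a₀`. -/
theorem reducedState_apply (c : C) (a₀ : Fin (dim c)) (ρ : Matrix (Config dim) (Config dim) ℂ)
    (a a' : Fin (dim c)) :
    reducedState c ρ a a' = ∑ b : Config dim,
      if b c = a₀ then ρ (Function.update b c a) (Function.update b c a') else 0 := by
  simp only [reducedState, ← Finset.sum_filter]
  refine Finset.sum_bij' (fun b _ => Function.update b c a₀) (fun b _ => Function.update b c a)
    ?_ ?_ ?_ ?_ ?_
  · simp
  · simp
  · intro b hb
    simp [← (Finset.mem_filter.1 hb).2]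
  · intro b hb
    simp [← (Finset.mem_filter.1 hb).2]
  · intro b hb
    simp [← (Finset.mem_filter.1 hb).2]

theorem trace_reducedState (c : C) (ρ : Matrix (Config dim) (Config dim) ℂ) :
    (reducedState c ρ).trace = ρ.trace := by
  simp only [Matrix.trace, Matrix.diag, reducedState]
  rw [Finset.sum_comm]
  simp

/-- Entries of the reduced state are expectations of matrix units on `c`, to which the Heisenberg
picture applies. -/
theorem reducedState_eq_trace (c : C) (ρ : Matrix (Config dim) (Config dim) ℂ)
    (a a' : Fin (dim c)) :
    reducedState c ρ a a' =
      (extendOp {c} (fun x y => if x ⟨c, Finset.mem_singleton_self c⟩ = a' ∧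
        y ⟨c, Finset.mem_singleton_self c⟩ = a then 1 else 0) * ρ).trace := by
  rw [Matrix.trace_mul_comm]
  simp only [Matrix.trace, Matrix.diag, Matrix.mul_apply, reducedState]
  refine Finset.sum_congr rfl fun b _ => ?_
  rw [Finset.sum_eq_single (Function.update b c a')]
  · simp +contextual [extendOp]
  · intro b' _ hb'
    simp only [extendOp, Finset.mem_singleton, Finset.restrict_def, mul_ite, mul_zero]
    split_ifs with h1 h2
    · refine absurd (funext fun c' => ?_) hb'
      by_cases hc' : c' = c
      · subst hc'; simp [h2.1]
      · simp [hc', h1 c' hc']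
    · simp [h2]
    · rfl
  · simp

end Operators

/-! Necessity of the two conditions. -/

section Run

variable {d n : ℕ} {C : Type} [Fintype C] [DecidableEq C] {dim : C → ℕ}

/-- The state that results from a sequence of steps. -/
noncomputable def SummoningTask.run (T : SummoningTask d n) (J : Set (Fin n))
    (l : List (Step d n dim)) (ρ : Matrix (Config dim) (Config dim) ℂ) :
    Matrix (Config dim) (Config dim) ℂ :=
  l.foldl (fun ρ a => applyOn a.carriers (a.op (T.heard J a.point)) ρ) ρ

theorem SummoningTask.run_append (T : SummoningTask d n) (J : Set (Fin n))
    (l l' : List (Step d n dim)) (ρ : Matrix (Config dim) (Config dim) ℂ) :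
    T.run J (l ++ l') ρ = T.run J l' (T.run J l ρ) :=
  List.foldl_append

theorem SummoningTask.run_singleton (T : SummoningTask d n) (J : Set (Fin n))
    (a : Step d n dim) (ρ : Matrix (Config dim) (Config dim) ℂ) :
    T.run J [a] ρ = applyOn a.carriers (a.op (T.heard J a.point)) ρ := rfl

theorem SummoningTask.trace_run (T : SummoningTask d n) (J : Set (Fin n))
    (l : List (Step d n dim)) (ρ : Matrix (Config dim) (Config dim) ℂ) :
    (T.run J l ρ).trace = ρ.trace := by
  induction l using List.reverseRecOn with
  | nil => rfl
  | append_singleton l a ih => rw [T.run_append, T.run_singleton, trace_applyOn, ih]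

theorem SummoningTask.heard_congr (T : SummoningTask d n) {J J' : Set (Fin n)} {z p : Minkowski d}
    (h : ∀ j, z ∈ futureCone (T.call j) → (j ∈ J ↔ j ∈ J')) (hp : z ∈ futureCone p) :
    T.heard J p = T.heard J' p := by
  ext j
  simp only [heard, Set.mem_ofPred_eq]
  exact and_congr_left fun hj => h j (futureCone_trans hj hp)

/-- In the Heisenberg picture, an observable on carriers that are handed over at `z` evolves to an
observable on these and on carriers which are used in the past of `z`, in a way that depends only
on the calls in the past of `z`. -/
theorem SummoningTask.exists_heisenberg (T : SummoningTask d n) {J J' : Set (Fin n)}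
    {z : Minkowski d} (hJ : ∀ j, z ∈ futureCone (T.call j) → (j ∈ J ↔ j ∈ J'))
    (l : List (Step d n dim))
    (hl : l.Pairwise fun a b => (a.carriers ∩ b.carriers).Nonempty → b.point ∈ futureCone a.point)
    (S : Finset C) (hS : ∀ a ∈ l, (a.carriers ∩ S).Nonempty → z ∈ futureCone a.point)
    (A : Matrix (Config dim) (Config dim) ℂ) (hA : IsLocalTo S A) :
    ∃ (S' : Finset C) (A' : Matrix (Config dim) (Config dim) ℂ), IsLocalTo S' A' ∧
      (∀ c ∈ S', c ∈ S ∨ ∃ a ∈ l, c ∈ a.carriers ∧ z ∈ futureCone a.point) ∧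
      ∀ ρ, (A * T.run J l ρ).trace = (A' * ρ).trace ∧
        (A * T.run J' l ρ).trace = (A' * ρ).trace := by
  induction l using List.reverseRecOn generalizing S A with
  | nil => exact ⟨S, A, hA, fun c hc => Or.inl hc, fun ρ => ⟨rfl, rfl⟩⟩
  | append_singleton l a ih =>
    rw [List.pairwise_append] at hl
    obtain ⟨hl, -, hla⟩ := hl
    simp only [T.run_append, T.run_singleton, trace_mul_applyOn]
    -- A last step that touches the support lies in the past of `z`, acts alike for `J` and `J'`,
    -- and adds its carriers to the support. Any other step has no effect, whatever calls it has
    -- heard.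
    by_cases ha : (a.carriers ∩ S).Nonempty
    · have hz := hS a (by simp) ha
      rw [T.heard_congr hJ hz]
      obtain ⟨S', A', hA', hS', h⟩ := ih hl (S ∪ a.carriers) (fun b hb hne => by
          obtain ⟨c, hc⟩ := hne
          rw [Finset.mem_inter, Finset.mem_union] at hc
          rcases hc.2 with hcS | hca
          · exact hS b (by simp [hb]) ⟨c, Finset.mem_inter.2 ⟨hc.1, hcS⟩⟩
          · exact futureCone_trans
              (hla b hb a (by simp) ⟨c, Finset.mem_inter.2 ⟨hc.1, hca⟩⟩) hz)
        _ (hA.pullback (a.op (T.heard J' a.point)))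
      refine ⟨S', A', hA', fun c hc => ?_, h⟩
      rcases hS' c hc with hc | ⟨b, hb, hcb⟩
      · rcases Finset.mem_union.1 hc with hc | hc
        · exact Or.inl hc
        · exact Or.inr ⟨a, by simp, hc, hz⟩
      · exact Or.inr ⟨b, by simp [hb], hcb⟩
    · have hdisj : Disjoint a.carriers S := by
        rwa [Finset.disjoint_iff_inter_eq_empty, ← Finset.not_nonempty_iff_eq_empty]
      simp only [hA.pullback_of_disjoint hdisj]
      obtain ⟨S', A', hA', hS', h⟩ := ih hl S (fun b hb => hS b (by simp [hb])) A hA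
      refine ⟨S', A', hA', fun c hc => ?_, h⟩
      rcases hS' c hc with hc | ⟨b, hb, hcb⟩
      · exact Or.inl hc
      · exact Or.inr ⟨b, by simp [hb], hcb⟩

/-- A sequence of steps acts by Kraus operators. -/
theorem SummoningTask.exists_kraus (T : SummoningTask d n) (J : Set (Fin n))
    (l : List (Step d n dim)) :
    ∃ (ι : Type) (_ : Fintype ι) (M : ι → Matrix (Config dim) (Config dim) ℂ),
      ∀ ρ, T.run J l ρ = ∑ i, M i * ρ * (M i).conjTranspose := by
  induction l using List.reverseRecOn with
  | nil => exact ⟨Unit, inferInstance, fun _ => 1, fun ρ => by simp [run]⟩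
  | append_singleton l a ih =>
    obtain ⟨ι, _, M, hM⟩ := ih
    refine ⟨Fin (a.op (T.heard J a.point)).rank × ι, inferInstance,
      fun x => extendOp a.carriers ((a.op (T.heard J a.point)).kraus x.1) * M x.2, fun ρ => ?_⟩
    rw [T.run_append, T.run_singleton, hM, applyOn, Fintype.sum_prod_type]
    simp only [Finset.mul_sum, Finset.sum_mul, Matrix.conjTranspose_mul, Matrix.mul_assoc]

end Run

theorem mul_ketBra_mul_conjTranspose {X : Type} [Fintype X] (M : Matrix X X ℂ) (v : X → ℂ) :
    M * ketBra v * M.conjTranspose = ketBra (M.mulVec v) := by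
  rw [ketBra, ketBra, Matrix.mul_vecMulVec, Matrix.vecMulVec_mul, Matrix.star_mulVec]

theorem trace_ketBra {X : Type} [Fintype X] (v : X → ℂ) :
    (ketBra v).trace = ((∑ x, ‖v x‖ ^ 2 : ℝ) : ℂ) := by
  simp [ketBra, Matrix.trace, Matrix.vecMulVec_apply, Complex.mul_conj']

/-! ### Amplitudes of the Kraus branches, and no cloning. -/

section Pure

variable {C : Type} [Fintype C] [DecidableEq C] {dim : C → ℕ}

theorem reducedState_sum_ketBra {ι : Type*} [Fintype ι] (v : ι → Config dim → ℂ) (c : C)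
    (a₀ a a' : Fin (dim c)) :
    reducedState c (∑ i, ketBra (v i)) a a' = ∑ b : Config dim, if b c = a₀ then
      ∑ i, v i (Function.update b c a) * star (v i (Function.update b c a')) else 0 := by
  rw [reducedState_apply c a₀]
  simp [ketBra, Matrix.sum_apply, Matrix.vecMulVec_apply]

/-- An expectation value of the reduced state is a sum of squares over all branches, so it can
vanish only if each amplitude does. -/
theorem dotProduct_reducedState {ι : Type*} [Fintype ι] (v : ι → Config dim → ℂ) (c : C)
    (a₀ a a' : Fin (dim c)) (x y : ℂ) :
    x * reducedState c (∑ i, ketBra (v i)) a a * star x +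
      x * reducedState c (∑ i, ketBra (v i)) a a' * star y +
      y * reducedState c (∑ i, ketBra (v i)) a' a * star x +
      y * reducedState c (∑ i, ketBra (v i)) a' a' * star y =
    ((∑ b : Config dim, if b c = a₀ then
      ∑ i, ‖x * v i (Function.update b c a) + y * v i (Function.update b c a')‖ ^ 2 else 0 : ℝ) :
        ℂ) := by
  simp only [reducedState_sum_ketBra v c a₀, Finset.mul_sum, Finset.sum_mul,
    ← Finset.sum_add_distrib]
  push_cast
  refine Finset.sum_congr rfl fun b _ => ?_
  split_ifs
  · push_cast
    simp only [Finset.mul_sum, Finset.sum_mul, ← Finset.sum_add_distrib]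
    refine Finset.sum_congr rfl fun i _ => ?_
    rw [← Complex.mul_conj']
    simp only [map_add, map_mul, Complex.star_def]
    ring
  · simp

/-- If the superposition of two labels with coefficients `x`, `y` has no weight in the reduced
state, then it has no weight in any branch. -/
theorem branch_eq_zero {ι : Type*} [Fintype ι] (v : ι → Config dim → ℂ) (c : C)
    (a a' : Fin (dim c)) (x y : ℂ)
    (h : x * reducedState c (∑ i, ketBra (v i)) a a * star x +
      x * reducedState c (∑ i, ketBra (v i)) a a' * star y +
      y * reducedState c (∑ i, ketBra (v i)) a' a * star x +
      y * reducedState c (∑ i, ketBra (v i)) a' a' * star y = 0) (i : ι) (b : Config dim) :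
    x * v i (Function.update b c a) + y * v i (Function.update b c a') = 0 := by
  rw [dotProduct_reducedState v c (b c), Complex.ofReal_eq_zero,
    Finset.sum_eq_zero_iff_of_nonneg fun b _ => by split_ifs <;> positivity] at h
  have h := h b (Finset.mem_univ b)
  rw [if_pos rfl, Finset.sum_eq_zero_iff_of_nonneg fun i _ => by positivity] at h
  simpa using h i (Finset.mem_univ i)

/-- No cloning: a linear map cannot take a state to one with two faithful copies. -/
theorem no_cloning {k : ℕ} (a₀ a₁ : Fin k) (ha : a₀ ≠ a₁) {ι : Type*} [Fintype ι]
    (v : ι → (Fin k → ℂ) → Config dim → ℂ) (hadd : ∀ i φ ψ, v i (φ + ψ) = v i φ + v i ψ)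
    (hsmul : ∀ i (x : ℂ) φ, v i (x • φ) = x • v i φ)
    (c c' : C) (hcc' : c ≠ c') (hc : dim c = k) (hc' : dim c' = k)
    (h : ∀ φ : Fin k → ℂ, ∑ a, ‖φ a‖ ^ 2 = 1 → reducedState c (∑ i, ketBra (v i φ)) =
      (ketBra φ).submatrix (Fin.cast hc) (Fin.cast hc))
    (h' : ∀ φ : Fin k → ℂ, ∑ a, ‖φ a‖ ^ 2 = 1 → reducedState c' (∑ i, ketBra (v i φ)) =
      (ketBra φ).submatrix (Fin.cast hc') (Fin.cast hc')) : False := by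
  have hnorm : ∀ p : Fin k, ∑ a, ‖(Pi.single p 1 : Fin k → ℂ) a‖ ^ 2 = 1 := fun p => by
    rw [Finset.sum_eq_single p] <;> simp +contextual
  -- In every branch, a faithful copy of the basis state `p` carries the label `p` only.
  have hne : ∀ (e : C) (he : dim e = k), (∀ φ : Fin k → ℂ, ∑ a, ‖φ a‖ ^ 2 = 1 →
      reducedState e (∑ i, ketBra (v i φ)) = (ketBra φ).submatrix (Fin.cast he) (Fin.cast he)) →
      ∀ (p : Fin k) (i : ι) (b : Config dim), Fin.cast he (b e) ≠ p →
        v i (Pi.single p 1) b = 0 := by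
    intro e he H p i b hb
    have := branch_eq_zero (fun i => v i (Pi.single p 1)) e (b e) (b e) 1 0 (by
      rw [H _ (hnorm p)]
      simp [ketBra, Matrix.vecMulVec_apply, hb]) i b
    simpa using this
  set s : ℂ := (((Real.sqrt 2)⁻¹ : ℝ) : ℂ) with hs
  have hs2 : s * star s = 1 / 2 := by
    rw [hs, Complex.star_def, Complex.conj_ofReal, ← Complex.ofReal_mul, ← mul_inv,
      Real.mul_self_sqrt zero_le_two]
    norm_num
  have hs0 : s ≠ 0 := fun h0 => by norm_num [h0] at hs2
  have hsn : ‖s‖ ^ 2 = 1 / 2 := by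
    have : ((‖s‖ ^ 2 : ℝ) : ℂ) = ((1 / 2 : ℝ) : ℂ) := by
      push_cast
      rw [← Complex.mul_conj']
      exact hs2
    exact_mod_cast this
  set φ : Fin k → ℂ := s • (Pi.single a₀ 1 + Pi.single a₁ 1) with hφ
  have hφ0 : φ a₀ = s := by simp [hφ, ha]
  have hφ1 : φ a₁ = s := by simp [hφ, ha.symm]
  have hφn : ∑ a, ‖φ a‖ ^ 2 = 1 := by
    rw [← Finset.sum_subset (Finset.subset_univ {a₀, a₁}), Finset.sum_pair ha, hφ0, hφ1, hsn]
    · norm_num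
    · intro a _ ha'
      simp only [Finset.mem_insert, Finset.mem_singleton, not_or] at ha'
      simp [hφ, ha'.1, ha'.2]
  have hvφ : ∀ i b, v i φ b = s * (v i (Pi.single a₀ 1) b + v i (Pi.single a₁ 1) b) := by
    intro i b
    rw [hφ, hsmul, hadd]
    rfl
  have hzero : ∀ i b, v i (Pi.single a₀ 1) b = 0 := by
    intro i b
    by_cases hb : Fin.cast hc (b c) = a₀
    swap
    · exact hne c hc h a₀ i b hb
    by_cases hb' : Fin.cast hc' (b c') = a₀
    swap
    · exact hne c' hc' h' a₀ i b hb'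
    -- The combination `(1, -1)` has no weight in `φ`, so replacing `a₀` by `a₁` in the copy `c'`
    -- leaves the amplitude of `v i φ` unchanged. But then the two copies carry different labels,
    -- which neither basis state allows, so the amplitude is zero.
    have key := branch_eq_zero (fun i => v i φ) c' (Fin.cast hc'.symm a₀) (Fin.cast hc'.symm a₁)
      1 (-1) (by
        rw [h' _ hφn]
        simp [ketBra, Matrix.vecMulVec_apply, hφ0, hφ1]) i b
    have hupd : Function.update b c' (Fin.cast hc'.symm a₀) = b := by
      rw [← hb']
      simp
    simp only [hupd, hvφ] at key
    rw [hne c hc h a₁ i b (hb ▸ ha),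
      hne c' hc' h' a₀ i (Function.update b c' (Fin.cast hc'.symm a₁)) (by simpa using ha.symm),
      hne c hc h a₁ i (Function.update b c' (Fin.cast hc'.symm a₁)) (by simpa [hcc', hb] using ha)]
      at key
    simpa [hs0] using key
  have h1 := congrFun (congrFun (h _ (hnorm a₀)) (Fin.cast hc.symm a₀)) (Fin.cast hc.symm a₀)
  rw [reducedState_sum_ketBra _ _ (Fin.cast hc.symm a₀)] at h1
  simp [hzero, ketBra, Matrix.vecMulVec_apply] at h1

end Pure

/-! ### Locality of protocols, and the two necessary conditions. -/

section Protocols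

variable {d n k : ℕ} {T : SummoningTask d n}

/-- The vector of the initial state of a protocol. -/
def Protocol.initialVector (P : Protocol T k) (φ : Fin k → ℂ) :
    Config (Carrier.dim (n := n) k P.auxDim) → ℂ :=
  fun b => if ∀ c, c ≠ Carrier.input → b c = P.ready c then φ (b Carrier.input) else 0

theorem Protocol.initialState_eq (P : Protocol T k) (φ : Fin k → ℂ) :
    P.initialState φ = ketBra (P.initialVector φ) := rfl

theorem Protocol.finalState_eq (P : Protocol T k) (J : Set (Fin n)) (φ : Fin k → ℂ) :
    P.finalState J φ = T.run J P.steps (P.initialState φ) := rfl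

/-- The input enters the support only through a step that lies after the start point and before the
reveal point. -/
theorem Protocol.exists_observable (P : Protocol T k) {J J' : Set (Fin n)} (j : Fin n)
    (hJ : ∀ i, T.reveal j ∈ futureCone (T.call i) → (i ∈ J ↔ i ∈ J')) (a a' : Fin k) :
    ∃ (S : Finset (Carrier n P.Aux)) (A : P.Operator), IsLocalTo S A ∧
      (Carrier.input ∈ S → T.reveal j ∈ futureCone T.start) ∧
      ∀ φ, P.revealed J φ j a a' = (A * P.initialState φ).trace ∧
        P.revealed J' φ j a a' = (A * P.initialState φ).trace := by
  obtain ⟨S, A, hA, hS, h⟩ := T.exists_heisenberg hJ P.steps P.steps_causal {Carrier.output j}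
    (fun b hb ⟨c, hc⟩ => by
      rw [Finset.mem_inter, Finset.mem_singleton] at hc
      exact P.output_causal b hb j (hc.2 ▸ hc.1)) _ (isLocalTo_extendOp _ _)
  refine ⟨S, A, hA, fun hin => ?_, fun φ => ?_⟩
  · rcases hS _ hin with h' | ⟨b, hb, hb', hz⟩
    · simp at h'
    · exact futureCone_trans (P.input_causal b hb hb') hz
  · simp only [Protocol.revealed, Protocol.finalState_eq]
    rw [reducedState_eq_trace, reducedState_eq_trace]
    exact h _

theorem Protocol.revealed_congr (P : Protocol T k) {J J' : Set (Fin n)} (j : Fin n)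
    (hJ : ∀ i, T.reveal j ∈ futureCone (T.call i) → (i ∈ J ↔ i ∈ J')) (φ : Fin k → ℂ) :
    P.revealed J φ j = P.revealed J' φ j := by
  ext a a'
  obtain ⟨S, A, -, -, h⟩ := P.exists_observable j hJ a a'
  rw [(h φ).1, (h φ).2]

/-- Without access to the input, the revealed state does not depend on the unknown state. -/
theorem Protocol.revealed_const (P : Protocol T k) (J : Set (Fin n)) (j : Fin n)
    (hj : T.reveal j ∉ futureCone T.start) (p q : Fin k) :
    P.revealed J (Pi.single p 1) j = P.revealed J (Pi.single q 1) j := by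
  ext a a'
  obtain ⟨S, A, hA, hS, h⟩ := P.exists_observable (J := J) j (fun _ _ => Iff.rfl) a a'
  have hin : Disjoint {Carrier.input} S := Finset.disjoint_singleton_left.2 fun hin => hj (hS hin)
  -- The matrix units on the input turn the initial vector for `q` into that for `p`. They commute
  -- with `A`, so they can be moved around the trace until `W q p * W p q` acts trivially on the
  -- vector for `q`.
  set W : Fin k → Fin k → P.Operator := fun p q => extendOp {Carrier.input} (Matrix.of fun x y =>
    if x ⟨Carrier.input, Finset.mem_singleton_self _⟩ = p ∧
      y ⟨Carrier.input, Finset.mem_singleton_self _⟩ = q then 1 else 0) with hW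
  have hWv : ∀ p q, (W p q).mulVec (P.initialVector (Pi.single q 1)) =
      P.initialVector (Pi.single p 1) := by
    intro p q
    funext b
    rw [Matrix.mulVec, dotProduct, Finset.sum_eq_single (Function.update b Carrier.input q)]
    · by_cases hb : ∀ c, c ≠ Carrier.input → b c = P.ready c
      · have hb' : ∀ c, c ≠ Carrier.input →
            Function.update b Carrier.input q c = P.ready c := fun c hc => by
          rw [Function.update_of_ne hc, hb c hc]
        have hoff : ∀ c, c ∉ ({Carrier.input} : Finset (Carrier n P.Aux)) →
            b c = Function.update b Carrier.input q c := fun c hc => by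
          rw [Function.update_of_ne (by simpa using hc)]
        simp only [hW, Protocol.initialVector, if_pos hb, if_pos hb', extendOp, if_pos hoff, Matrix.of_apply,
          Finset.restrict_def, Function.update_self, and_true, Pi.single_eq_same, mul_one,
          Pi.single_apply]
      · have hb' : ¬ ∀ c, c ≠ Carrier.input →
            Function.update b Carrier.input q c = P.ready c := fun h => hb fun c hc => by
          rw [← h c hc, Function.update_of_ne hc]
        simp only [Protocol.initialVector, if_neg hb, if_neg hb', mul_zero]
    · intro b' _ hb'
      simp only [hW, extendOp, Matrix.of_apply]
      split_ifs with h1 h2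
      · refine absurd (funext fun c => ?_) hb'
        by_cases hc : c = Carrier.input
        · subst hc
          rw [Function.update_self]
          exact h2.2
        · rw [Function.update_of_ne hc]
          exact (h1 c (by simpa using hc)).symm
      · exact zero_mul _
      · exact zero_mul _
    · simp
  have hWt : (W p q).conjTranspose = W q p := by
    rw [hW, ← extendOp_conjTranspose]
    congr 1
    ext x y
    simp only [Matrix.conjTranspose_apply, Matrix.of_apply, apply_ite star, star_one, star_zero, and_comm]
  have hpq : (W p q).conjTranspose * (W p q * ketBra (P.initialVector (Pi.single q 1))) =
      ketBra (P.initialVector (Pi.single q 1)) := by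
    rw [hWt, ketBra, Matrix.mul_vecMulVec, Matrix.mul_vecMulVec, hWv, hWv]
  rw [(h _).1, (h _).1, P.initialState_eq, P.initialState_eq, ← hWv p q,
    ← mul_ketBra_mul_conjTranspose, ← Matrix.mul_assoc, Matrix.trace_mul_comm]
  conv_rhs => rw [← hpq]
  have hcomm : A * W q p = W q p * A := hA _ hin _
  rw [hWt, ← Matrix.mul_assoc A (W q p), hcomm]
  simp only [Matrix.mul_assoc]

theorem Protocol.Succeeds.reveal_mem_futureCone_start {P : Protocol T k} (hP : P.Succeeds)
    (hk : 2 ≤ k) (j : Fin n) : T.reveal j ∈ futureCone T.start := by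
  by_contra hj
  have hnorm : ∀ p : Fin k, ∑ a, ‖(Pi.single p 1 : Fin k → ℂ) a‖ ^ 2 = 1 := fun p => by
    rw [Finset.sum_eq_single p] <;> simp +contextual
  have h := P.revealed_const {j} j hj ⟨0, by omega⟩ ⟨1, by omega⟩
  rw [hP j _ (hnorm _), hP j _ (hnorm _)] at h
  have h := congrFun (congrFun h ⟨0, by omega⟩) ⟨0, by omega⟩
  simp [ketBra, Matrix.vecMulVec_apply, Fin.ext_iff] at h

/-- Success demands nothing when two calls are made. Locality alone carries both single-call
guarantees over to that run, and the run would be a cloner. -/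
theorem Protocol.Succeeds.reveal_mem_futureCone_call {P : Protocol T k} (hP : P.Succeeds)
    (hk : 2 ≤ k) (i j : Fin n) :
    T.reveal j ∈ futureCone (T.call i) ∨ T.reveal i ∈ futureCone (T.call j) := by
  by_contra! hij
  have hne : i ≠ j := by
    rintro rfl
    exact hij.1 (T.reveal_mem i)
  obtain ⟨ι, _, M, hM⟩ := T.exists_kraus {i, j} P.steps
  have hfinal : ∀ φ, P.finalState {i, j} φ =
      ∑ x, ketBra ((M x).mulVec (P.initialVector φ)) := fun φ => by
    rw [P.finalState_eq, hM, P.initialState_eq]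
    simp only [mul_ketBra_mul_conjTranspose]
  have hi : ∀ φ : Fin k → ℂ, ∑ a, ‖φ a‖ ^ 2 = 1 → P.revealed {i, j} φ i = ketBra φ :=
    fun φ hφ => by
      rw [← hP i φ hφ]
      refine P.revealed_congr i (fun l hl => ?_) φ
      have : l ≠ j := by rintro rfl; exact hij.2 hl
      simp [this]
  have hj : ∀ φ : Fin k → ℂ, ∑ a, ‖φ a‖ ^ 2 = 1 → P.revealed {i, j} φ j = ketBra φ :=
    fun φ hφ => by
      rw [← hP j φ hφ]
      refine P.revealed_congr j (fun l hl => ?_) φ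
      have : l ≠ i := by rintro rfl; exact hij.1 hl
      simp [this]
  have hadd : ∀ φ ψ, P.initialVector (φ + ψ) = P.initialVector φ + P.initialVector ψ := by
    intro φ ψ
    funext b
    simp only [Protocol.initialVector, Pi.add_apply]
    split_ifs <;> simp
  have hsmul : ∀ (x : ℂ) φ, P.initialVector (x • φ) = x • P.initialVector φ := by
    intro x φ
    funext b
    simp only [Protocol.initialVector, Pi.smul_apply]
    split_ifs <;> simp
  refine no_cloning (⟨0, by omega⟩ : Fin k) ⟨1, by omega⟩ (by simp)
    (fun x φ => (M x).mulVec (P.initialVector φ))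
    (fun x φ ψ => by rw [hadd, Matrix.mulVec_add]) (fun x y φ => by rw [hsmul, Matrix.mulVec_smul])
    (Carrier.output i) (Carrier.output j) (by simpa using hne) rfl rfl (fun φ hφ => ?_)
    (fun φ hφ => ?_)
  · rw [← hfinal]
    exact hi φ hφ
  · rw [← hfinal]
    exact hj φ hφ

end Protocols

/-! Quantum operations that act on state vectors in a simple way. -/

section Operations

variable {C : Type} [Fintype C] [DecidableEq C] {dim : C → ℕ}

/-- The quantum operation given by a unitary. -/
def QuantumOp.ofUnitary {X : Type} [Fintype X] [DecidableEq X] (U : Matrix X X ℂ)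
    (hU : U.conjTranspose * U = 1) : QuantumOp X where
  rank := 1
  kraus _ := U
  complete := by simpa using hU

theorem applyOn_ofUnitary (S : Finset C) (U : Matrix (SubConfig dim S) (SubConfig dim S) ℂ)
    (hU : U.conjTranspose * U = 1) (v : Config dim → ℂ) :
    applyOn S (QuantumOp.ofUnitary U hU) (ketBra v) = ketBra ((extendOp S U).mulVec v) := by
  simp only [applyOn, mul_ketBra_mul_conjTranspose]
  exact Fin.sum_univ_one _

theorem extendOp_mulVec (S : Finset C) (K : Matrix (SubConfig dim S) (SubConfig dim S) ℂ)
    (v : Config dim → ℂ) (b : Config dim) :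
    (extendOp S K).mulVec v b = ∑ y, K (S.restrict b) y * v (glue S b y) := by
  rw [Matrix.mulVec, dotProduct]
  simp only [extendOp, ite_mul, zero_mul]
  rw [sum_agree S b fun b₁ => K (S.restrict b) (S.restrict b₁) * v b₁]
  simp

theorem exists_idle_op (S : Finset C) : ∃ Φ : QuantumOp (SubConfig dim S),
    ∀ v, applyOn S Φ (ketBra v) = ketBra v :=
  ⟨QuantumOp.ofUnitary 1 (by simp), fun v => by
    rw [applyOn_ofUnitary, extendOp_one, Matrix.one_mulVec]⟩

/-- A permutation of the product basis with phases is a quantum operation on the carriers on which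
it depends. -/
theorem exists_monomial_op (S : Finset C) (r : Config dim) (τ : Config dim → Config dim)
    (θ : Config dim → ℂ) (hτ : Function.Injective τ) (hθ : ∀ b, ‖θ b‖ = 1)
    (hoff : ∀ b, ∀ c, c ∉ S → τ b c = b c)
    (hτS : ∀ b b', (∀ c ∈ S, b c = b' c) → ∀ c ∈ S, τ b c = τ b' c)
    (hθS : ∀ b b', (∀ c ∈ S, b c = b' c) → θ b = θ b') :
    ∃ Φ : QuantumOp (SubConfig dim S),
      ∀ v, applyOn S Φ (ketBra v) = ketBra fun b => θ b * v (τ b) := by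
  -- This is `τ` as seen on `S`; `r` merely fills in the labels elsewhere.
  set f : SubConfig dim S → SubConfig dim S := fun x => S.restrict (τ (glue S r x)) with hf
  have hfinj : Function.Injective f := by
    intro x x' h
    have h1 : τ (glue S r x) = τ (glue S r x') := by
      funext c
      by_cases hc : c ∈ S
      · exact restrict_eq_iff.1 h c hc
      · rw [hoff _ c hc, hoff _ c hc, glue_apply_not_mem hc, glue_apply_not_mem hc]
    rw [← restrict_glue S r x, hτ h1, restrict_glue]
  have hfbij := Finite.injective_iff_bijective.1 hfinj
  -- Row `x` has its entry in column `f x`: amplitudes are pulled back along `τ`, so basis states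
  -- move by the inverse of `τ`. Hence the maps used for the protocol below describe its operations
  -- backwards.
  set U : Matrix (SubConfig dim S) (SubConfig dim S) ℂ :=
    Matrix.of fun x y => if y = f x then θ (glue S r x) else 0 with hU
  have hUU : U.conjTranspose * U = 1 := by
    ext y y'
    rw [Matrix.mul_apply]
    obtain ⟨x, rfl⟩ := hfbij.2 y
    rw [Finset.sum_eq_single x]
    · simp only [hU, Matrix.conjTranspose_apply, Matrix.of_apply, if_true, Matrix.one_apply,
        eq_comm (a := y'), mul_ite, mul_zero]
      rw [mul_comm, Complex.star_def, Complex.mul_conj', hθ]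
      simp
    · intro x' _ hx'
      simp only [hU, Matrix.conjTranspose_apply, Matrix.of_apply]
      rw [if_neg fun h => hx' (hfinj h).symm]
      simp
    · simp
  refine ⟨QuantumOp.ofUnitary U hUU, fun v => ?_⟩
  rw [applyOn_ofUnitary]
  congr 1
  funext b
  rw [extendOp_mulVec, Finset.sum_eq_single (f (S.restrict b))]
  · have hagree : ∀ c ∈ S, glue S r (S.restrict b) c = b c := fun c hc => by simp [hc]
    have h1 : f (S.restrict b) = S.restrict (τ b) := restrict_eq_iff.2 (hτS _ _ hagree)
    rw [h1, glue_restrict_of_agree fun c hc => (hoff b c hc).symm, ← h1]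
    simp only [hU, Matrix.of_apply, if_true]
    rw [hθS _ _ hagree]
  · intro y _ hy
    simp [hU, hy]
  · simp

end Operations

/-! ### Operations and reduced states when all carriers have dimension `k`. -/

section Uniform

variable {C : Type} [Fintype C] [DecidableEq C] {k : ℕ}

omit [Fintype C] in
theorem sum_subConfig_singleton {M : Type*} [AddCommMonoid M] (c : C)
    (f : SubConfig (fun _ : C => k) {c} → M) : ∑ y, f y = ∑ a : Fin k, f fun _ => a :=
  (Fintype.sum_bijective (fun a : Fin k => (fun _ => a : SubConfig (fun _ : C => k) {c}))
    ⟨fun a a' h => congrFun h ⟨c, Finset.mem_singleton_self c⟩, fun y =>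
      ⟨y ⟨c, Finset.mem_singleton_self c⟩, funext fun ⟨c', hc'⟩ => by
        obtain rfl := Finset.mem_singleton.1 hc'
        rfl⟩⟩ _ _ fun _ => rfl).symm

omit [Fintype C] in
theorem glue_singleton (c : C) (b : Config fun _ : C => k) (a : Fin k) :
    glue {c} b (fun _ => a) = Function.update b c a := by
  funext c'
  by_cases hc : c' = c
  · subst hc; simp [glue]
  · simp [glue, hc]

/-- A unitary on a single carrier is a quantum operation. -/
theorem exists_single_carrier_op (c : C) (F : Matrix (Fin k) (Fin k) ℂ)
    (hF : F.conjTranspose * F = 1) :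
    ∃ Φ : QuantumOp (SubConfig (fun _ : C => k) {c}),
      ∀ v, applyOn {c} Φ (ketBra v) =
        ketBra fun b => ∑ a, F (b c) a * v (Function.update b c a) := by
  set e : SubConfig (fun _ : C => k) {c} → Fin k :=
    fun y => y ⟨c, Finset.mem_singleton_self c⟩ with he
  have hinj : Function.Injective e := fun y y' h => funext fun ⟨c', hc'⟩ => by
    obtain rfl := Finset.mem_singleton.1 hc'
    exact h
  have hU : (F.submatrix e e).conjTranspose * F.submatrix e e = 1 := by
    ext y y'
    rw [Matrix.mul_apply, sum_subConfig_singleton]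
    have := congrFun (congrFun hF (e y)) (e y')
    rw [Matrix.mul_apply] at this
    simpa [Matrix.one_apply, hinj.eq_iff] using this
  refine ⟨QuantumOp.ofUnitary _ hU, fun v => ?_⟩
  rw [applyOn_ofUnitary]
  congr 1
  funext b
  rw [extendOp_mulVec, sum_subConfig_singleton]
  simp only [glue_singleton]
  rfl

theorem ketBra_zero {X : Type} : ketBra (0 : X → ℂ) = 0 := by
  ext
  simp [ketBra, Matrix.vecMulVec_apply]

/-- Resetting the carriers in `S` to a uniform superposition of configurations is a quantum
operation. -/
theorem exists_reset_op (S : Finset C) (r : Config fun _ : C => k)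
    (code : (Config fun _ : C => k) → Prop) [DecidablePred code]
    (hcode : ∀ b b', (∀ c ∈ S, b c = b' c) → (code b ↔ code b')) (hr : code r) :
    ∃ (Φ : QuantumOp (SubConfig (fun _ : C => k) S)) (κ : ℂ),
      ∀ v : (Config fun _ : C => k) → ℂ, (∀ b, v b ≠ 0 → ∀ c ∈ S, b c = r c) →
        applyOn S Φ (ketBra v) =
          ketBra fun b => if code b then κ * v (glue S b (S.restrict r)) else 0 := by
  set N : ℕ := (Finset.univ.filter fun y : SubConfig (fun _ : C => k) S => code (glue S r y)).card
    with hN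
  have hN0 : (N : ℝ) ≠ 0 := by
    rw [Nat.cast_ne_zero, hN]
    refine (Finset.card_pos.2 ⟨S.restrict r, ?_⟩).ne'
    rw [Finset.mem_filter, glue_restrict_of_agree fun _ _ => rfl]
    exact ⟨Finset.mem_univ _, hr⟩
  set κ : ℂ := (((Real.sqrt N)⁻¹ : ℝ) : ℂ) with hκ
  have hκN : N * (star κ * κ) = 1 := by
    rw [hκ, Complex.star_def, Complex.conj_ofReal, ← Complex.ofReal_mul, ← mul_inv,
      Real.mul_self_sqrt (Nat.cast_nonneg _), ← Complex.ofReal_natCast, ← Complex.ofReal_mul,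
      mul_inv_cancel₀ hN0, Complex.ofReal_one]
  -- `K x` sends the basis state `x` to the normalized code superposition and kills all others; on
  -- the ready state only one Kraus operator contributes.
  set K : SubConfig (fun _ : C => k) S →
      Matrix (SubConfig (fun _ : C => k) S) (SubConfig (fun _ : C => k) S) ℂ :=
    fun x => Matrix.of fun y y' => if y' = x ∧ code (glue S r y) then κ else 0 with hK
  have hcomplete : ∑ x, (K x).conjTranspose * K x = 1 := by
    ext y y'
    simp only [Matrix.sum_apply, Matrix.mul_apply, Matrix.conjTranspose_apply, hK, Matrix.of_apply]
    rw [Finset.sum_eq_single y]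
    · by_cases hy : y' = y
      · subst hy
        simp only [true_and, apply_ite star, star_zero, ite_mul, zero_mul, mul_ite, mul_zero]
        rw [Matrix.one_apply_eq, ← hκN, hN, Finset.card_filter]
        push_cast
        rw [Finset.sum_mul]
        refine Finset.sum_congr rfl fun x _ => ?_
        split_ifs <;> simp
      · simp [hy, Matrix.one_apply_ne (Ne.symm hy)]
    · intro x _ hx
      simp [Ne.symm hx]
    · simp
  set e := (Fintype.equivFin (SubConfig (fun _ : C => k) S)).symm with he
  refine ⟨⟨_, fun i => K (e i), ?_⟩, κ, fun v hv => ?_⟩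
  · rw [e.sum_comp fun x => (K x).conjTranspose * K x]
    exact hcomplete
  · simp only [applyOn, mul_ketBra_mul_conjTranspose]
    rw [e.sum_comp fun x => ketBra ((extendOp S (K x)).mulVec v)]
    have happ : ∀ x b, (extendOp S (K x)).mulVec v b =
        if code b then κ * v (glue S b x) else 0 := by
      intro x b
      rw [extendOp_mulVec, Finset.sum_eq_single x]
      · have : code (glue S r (S.restrict b)) ↔ code b :=
          hcode _ _ fun c hc => by simp [hc]
        simp only [hK, Matrix.of_apply, true_and, this, ite_mul, zero_mul]
      · intro y _ hy
        simp [hK, hy]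
      · simp
    rw [Finset.sum_eq_single (S.restrict r)]
    · congr 1
      funext b
      exact happ _ b
    · intro x _ hx
      rw [← ketBra_zero]
      congr 1
      funext b
      rw [happ]
      have : v (glue S b x) = 0 := by
        by_contra hne
        refine hx (funext fun ⟨c, hc⟩ => ?_)
        simpa [hc] using hv _ hne c hc
      simp [this]
    · simp

/-- A unitary matrix all of whose entries have the same absolute value. -/
theorem exists_flat_unitary (k : ℕ) [NeZero k] : ∃ F : Matrix (Fin k) (Fin k) ℂ,
    F.conjTranspose * F = 1 ∧ ∀ h a, ‖F h a‖ ^ 2 = (k : ℝ)⁻¹ := by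
  have hk : (k : ℝ) ≠ 0 := Nat.cast_ne_zero.2 (NeZero.ne k)
  set ψ : AddChar (ZMod k) ℂ := ZMod.stdAddChar with hψ
  set e : Fin k ≃ ZMod k := (ZMod.finEquiv k).toEquiv with he
  set s : ℂ := (((Real.sqrt k)⁻¹ : ℝ) : ℂ) with hs
  have hss : star s * s = (k : ℂ)⁻¹ := by
    rw [hs, Complex.star_def, Complex.conj_ofReal, ← Complex.ofReal_mul, ← mul_inv,
      Real.mul_self_sqrt (Nat.cast_nonneg _), Complex.ofReal_inv, Complex.ofReal_natCast]
  -- The discrete Fourier transform, unitary by orthogonality of characters.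
  refine ⟨Matrix.of fun h a => s * ψ (e h * e a), ?_, fun h a => ?_⟩
  · ext a a'
    rw [Matrix.mul_apply]
    have h1 : ∀ h, star (s * ψ (e h * e a)) * (s * ψ (e h * e a')) =
        star s * s * ψ (e h * (e a' - e a)) := by
      intro h
      rw [star_mul', mul_sub, sub_eq_add_neg, AddChar.map_add_eq_mul, AddChar.map_neg_eq_conj,
        Complex.star_def]
      ring
    simp only [Matrix.conjTranspose_apply, Matrix.of_apply, h1]
    rw [← Finset.mul_sum, e.sum_comp fun h => ψ (h * (e a' - e a)),
      AddChar.sum_mulShift _ (ZMod.isPrimitive_stdAddChar k), hss, ZMod.card, Matrix.one_apply]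
    simp only [sub_eq_zero, e.injective.eq_iff, eq_comm (a := a)]
    split_ifs
    · exact inv_mul_cancel₀ (Nat.cast_ne_zero.2 (NeZero.ne k))
    · simp
  · simp only [Matrix.of_apply, norm_mul, AddChar.norm_apply, mul_one]
    have : ((‖s‖ ^ 2 : ℝ) : ℂ) = (((k : ℝ)⁻¹ : ℝ) : ℂ) := by
      push_cast
      rw [← hss, Complex.star_def, Complex.conj_mul']
    exact_mod_cast this

/-- If the carrier `c` is in a product state with the rest, its reduced state is its own state. -/
theorem reducedState_of_product (c : C) (φ : Fin k → ℂ) (v w : (Config fun _ : C => k) → ℂ)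
    (hv : ∀ b, v b = φ (b c) * w b) (hw : ∀ b a, w (Function.update b c a) = w b)
    (hφ : ∑ a, ‖φ a‖ ^ 2 = 1) (htrace : (ketBra v).trace = 1) (a₀ : Fin k) :
    reducedState c (ketBra v) = ketBra φ := by
  set t : ℂ := ∑ b : Config fun _ : C => k, if b c = a₀ then w b * star (w b) else 0 with ht
  have h1 : reducedState c (ketBra v) = t • ketBra φ := by
    ext a a'
    rw [reducedState_apply c a₀, Matrix.smul_apply, smul_eq_mul, ht, Finset.sum_mul]
    refine Finset.sum_congr rfl fun b _ => ?_
    split_ifs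
    · simp only [ketBra, Matrix.vecMulVec_apply, Pi.star_apply, hv, hw, star_mul',
        Function.update_self]
      ring
    · simp
  -- The trace forces the scalar `t` to be one, so the norm of `w` is never computed.
  have h2 := trace_reducedState c (ketBra v)
  rw [h1, Matrix.trace_smul, trace_ketBra, hφ, htrace] at h2
  rw [h1, show t = 1 by simpa using h2, one_smul]

theorem trace_ketBra_initial (c : C) (φ : Fin k → ℂ) (r : Config fun _ : C => k)
    (hφ : ∑ a, ‖φ a‖ ^ 2 = 1) :
    (ketBra fun b : Config fun _ : C => k =>
      if ∀ c', c' ≠ c → b c' = r c' then φ (b c) else 0).trace = 1 := by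
  rw [trace_ketBra, ← Complex.ofReal_one]
  congr 1
  have h := sum_agree (dim := fun _ : C => k) {c} r fun b => ‖φ (b c)‖ ^ 2
  rw [sum_subConfig_singleton] at h
  simp only [glue_singleton, Function.update_self, hφ] at h
  rw [← h]
  refine Finset.sum_congr rfl fun b _ => ?_
  simp only [Finset.mem_singleton, eq_comm (a := r _)]
  by_cases hb : ∀ c', c' ≠ c → b c' = r c'
  · rw [if_pos hb, if_pos hb]
  · rw [if_neg hb, if_neg hb]
    simp

end Uniform

/-! The summoning protocol. Half of a maximally entangled state is encoded beforehand into shares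
for the pairs of diamonds and for the single diamonds; the unknown state is teleported into this
code; each pair share is routed by its call point. -/

namespace Relay

/-- Auxiliary carriers: half of an entangled state, a pair share for each ordered pair of diamonds,
and two records of the teleportation outcome for each reveal point. -/
abbrev Ancilla (n : ℕ) : Type := Unit ⊕ (Fin n × Fin n) ⊕ Fin n ⊕ Fin n

instance (n : ℕ) : DecidableEq (Ancilla n) := inferInstance

instance (n : ℕ) : Fintype (Ancilla n) := inferInstance

variable {n k : ℕ}

/-- The half of the entangled state that is used for teleportation. -/
abbrev half : Carrier n (Ancilla n) := Sum.inr (Sum.inr (Sum.inl ()))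

/-- The carrier that brings the share of the pair `i`, `j` to the `i`-th reveal point. -/
abbrev share (i j : Fin n) : Carrier n (Ancilla n) :=
  Sum.inr (Sum.inr (Sum.inr (Sum.inl (i, j))))

/-- The record for the `j`-th reveal point of the teleportation shift. -/
abbrev shiftRecord (j : Fin n) : Carrier n (Ancilla n) :=
  Sum.inr (Sum.inr (Sum.inr (Sum.inr (Sum.inl j))))

/-- The record for the `j`-th reveal point of the teleportation phase. -/
abbrev phaseRecord (j : Fin n) : Carrier n (Ancilla n) :=
  Sum.inr (Sum.inr (Sum.inr (Sum.inr (Sum.inr j))))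

/-- Configurations of the relay protocol. -/
abbrev Labels (n k : ℕ) : Type := Config fun _ : Carrier n (Ancilla n) => k

/-- The label of the share of the pair `i`, `j`, which is
on its way to the `j`-th reveal point if `o i j` holds, and to the `i`-th one otherwise. -/
def pairLabel (o : Fin n → Fin n → Prop) [DecidableRel o] (b : Labels n k) (i j : Fin n) : Fin k :=
  if o i j then b (share j i) else b (share i j)

variable [NeZero k]

/-- The configurations of the code: for each diamond, its shares add up to the encoded label. -/
def IsCode (o : Fin n → Fin n → Prop) [DecidableRel o] (b : Labels n k) : Prop :=
  ∀ i, b (Carrier.output i) + ∑ l ∈ Finset.univ.erase i, pairLabel o b i l = b half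

instance (o : Fin n → Fin n → Prop) [DecidableRel o] :
    DecidablePred (IsCode (k := k) o) := fun b => by unfold IsCode; infer_instance

/-- Addition of the input label to the half of the entangled state. -/
def addInput (b : Labels n k) : Labels n k :=
  Function.update b half (b half + b Carrier.input)

/-- Subtraction of the teleportation outcome from the records. -/
def subRecords (b : Labels n k) : Labels n k
  | Sum.inr (Sum.inr (Sum.inr (Sum.inr (Sum.inl j)))) => b (shiftRecord j) - b half
  | Sum.inr (Sum.inr (Sum.inr (Sum.inr (Sum.inr j)))) => b (phaseRecord j) - b Carrier.input
  | c => b c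

/-- Exchange of the shares of the pairs that are routed at the `j`-th call point. -/
def reroute (o : Fin n → Fin n → Prop) [DecidableRel o] (j : Fin n) (b : Labels n k) : Labels n k
  | Sum.inr (Sum.inr (Sum.inr (Sum.inl (a, c)))) =>
    if (a = j ∧ o j c) ∨ (c = j ∧ o j a) then b (share c a) else b (share a c)
  | c => b c

/-- The inverse of the decoding at the `j`-th reveal point. -/
def encode (j : Fin n) (b : Labels n k) : Labels n k
  | Sum.inr (Sum.inl i) => if i = j then b (Carrier.output j) + b (shiftRecord j) -
      ∑ l ∈ Finset.univ.erase j, (b (share j l) + (b (Carrier.output j) + b (shiftRecord j)))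
    else b (Carrier.output i)
  | Sum.inr (Sum.inr (Sum.inr (Sum.inl (a, c)))) =>
    if a = j then b (share a c) + (b (Carrier.output j) + b (shiftRecord j)) else b (share a c)
  | c => b c

omit [NeZero k] in
theorem addInput_injective : Function.Injective (addInput : Labels n k → Labels n k) := by
  intro b b' h
  have h1 : ∀ c, c ≠ half → b c = b' c := fun c hc => by
    simpa [addInput, hc] using congrFun h c
  have h2 := congrFun h half
  simp only [addInput, Function.update_self, h1 Carrier.input (by simp), add_left_inj] at h2
  funext c
  by_cases hc : c = half
  · exact hc ▸ h2
  · exact h1 c hc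

theorem subRecords_injective : Function.Injective (subRecords : Labels n k → Labels n k) := by
  intro b b' h
  have hin : b Carrier.input = b' Carrier.input := congrFun h Carrier.input
  have hhalf : b half = b' half := congrFun h half
  funext c
  have hc := congrFun h c
  rcases c with c | c | c | c | c | c
  all_goals first
    | exact hc
    | simpa [subRecords, hin, hhalf] using hc

omit [NeZero k] in
theorem reroute_injective (o : Fin n → Fin n → Prop) [DecidableRel o] (j : Fin n) :
    Function.Injective (reroute o j : Labels n k → Labels n k) := by
  refine Function.Involutive.injective fun b => ?_
  funext c
  rcases c with c | c | c | ⟨a, c⟩ | c | c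
  all_goals try rfl
  simp only [reroute]
  split_ifs with h1 h2
  · rfl
  · exact absurd h1.symm h2
  · rfl

/-- The new output entry involves the shares only through shifted shares, which are themselves
entries of `encode j b`. So the output can be solved for before the shares. -/
theorem encode_injective (j : Fin n) :
    Function.Injective (encode j : Labels n k → Labels n k) := by
  intro b b' h
  have hG : ∀ i, b (shiftRecord i) = b' (shiftRecord i) := fun i => congrFun h (shiftRecord i)
  have hR : ∀ l, b (share j l) + (b (Carrier.output j) + b (shiftRecord j)) =
      b' (share j l) + (b' (Carrier.output j) + b' (shiftRecord j)) := fun l => by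
    simpa only [encode, if_true] using congrFun h (share j l)
  have hout : b (Carrier.output j) = b' (Carrier.output j) := by
    have := congrFun h (Carrier.output j)
    simp only [encode, if_true] at this
    rw [Finset.sum_congr rfl fun l _ => hR l, sub_left_inj, hG, add_left_inj] at this
    exact this
  funext c
  have hc := congrFun h c
  rcases c with c | i | c | ⟨a, c⟩ | c | c
  · exact hc
  · by_cases hi : i = j
    · exact hi ▸ hout
    · simpa [encode, hi] using hc
  · exact hc
  · by_cases ha : a = j
    · subst ha
      simpa [hout, hG] using hR c
    · simpa [encode, ha] using hc
  · exact hc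
  · exact hc

/-- The carriers that are prepared in the entangled code state. -/
def prepared (n : ℕ) : Finset (Carrier n (Ancilla n)) :=
  Finset.univ.filter fun c => c ≠ Carrier.input ∧ ∀ j, c ≠ shiftRecord j ∧ c ≠ phaseRecord j

/-- The carriers on which the teleportation outcome is recorded, and those that carry it. -/
def recorded (n : ℕ) : Finset (Carrier n (Ancilla n)) :=
  Finset.univ.filter fun c =>
    c = Carrier.input ∨ c = half ∨ ∃ j, c = shiftRecord j ∨ c = phaseRecord j

/-- The carriers that are used at the `j`-th call point. -/
def routed (o : Fin n → Fin n → Prop) [DecidableRel o] (j : Fin n) :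
    Finset (Carrier n (Ancilla n)) :=
  Finset.univ.filter fun c => ∃ l, o j l ∧ (c = share j l ∨ c = share l j)

/-- The carriers that are used at the `j`-th reveal point. -/
def collected (j : Fin n) : Finset (Carrier n (Ancilla n)) :=
  Finset.univ.filter fun c =>
    c = Carrier.output j ∨ c = shiftRecord j ∨ c = phaseRecord j ∨ ∃ l, c = share j l

theorem exists_addInput_op : ∃ Φ : QuantumOp (SubConfig (fun _ : Carrier n (Ancilla n) => k)
    {Carrier.input, half}), ∀ v, applyOn {Carrier.input, half} Φ (ketBra v) =
      ketBra fun b => v (addInput b) := by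
  obtain ⟨Φ, hΦ⟩ := exists_monomial_op (dim := fun _ : Carrier n (Ancilla n) => k)
    {Carrier.input, half} 0 addInput (fun _ => 1) addInput_injective (by simp)
    (fun b c hc => by
      simp only [Finset.mem_insert, Finset.mem_singleton, not_or] at hc
      simp [addInput, hc.2])
    (fun b b' h c _ => by
      have h1 := h Carrier.input (by simp)
      have h2 := h half (by simp)
      by_cases hc : c = half
      · subst hc; simp [addInput, h1, h2]
      · simp only [addInput, Function.update_of_ne hc]
        exact h c ‹_›)
    (fun _ _ _ => rfl)
  exact ⟨Φ, fun v => by simpa using hΦ v⟩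

theorem exists_subRecords_op : ∃ Φ : QuantumOp (SubConfig (fun _ : Carrier n (Ancilla n) => k)
    (recorded n)), ∀ v, applyOn (recorded n) Φ (ketBra v) =
      ketBra fun b => v (subRecords b) := by
  obtain ⟨Φ, hΦ⟩ := exists_monomial_op (dim := fun _ : Carrier n (Ancilla n) => k)
    (recorded n) 0 subRecords (fun _ => 1) subRecords_injective (by simp)
    (fun b c hc => by
      rcases c with c | c | c | c | c | c
      all_goals first
        | rfl
        | simp [recorded] at hc)
    (fun b b' h c hc => by
      have h1 := h Carrier.input (by simp [recorded])
      have h2 := h half (by simp [recorded])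
      have h3 := h c hc
      rcases c with c | c | c | c | c | c
      all_goals simp only [subRecords, h1, h2, h3])
    (fun _ _ _ => rfl)
  exact ⟨Φ, fun v => by simpa using hΦ v⟩

theorem exists_reroute_op (o : Fin n → Fin n → Prop) [DecidableRel o] (j : Fin n) :
    ∃ Φ : QuantumOp (SubConfig (fun _ : Carrier n (Ancilla n) => k) (routed o j)),
      ∀ v, applyOn (routed o j) Φ (ketBra v) = ketBra fun b => v (reroute o j b) := by
  obtain ⟨Φ, hΦ⟩ := exists_monomial_op (dim := fun _ : Carrier n (Ancilla n) => k)
    (routed o j) 0 (reroute o j) (fun _ => 1) (reroute_injective o j) (by simp)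
    (fun b c hc => by
      rcases c with c | c | c | ⟨a, c⟩ | c | c
      all_goals try rfl
      simp only [reroute]
      rw [if_neg]
      rintro (⟨rfl, h⟩ | ⟨rfl, h⟩)
      · exact hc (Finset.mem_filter.2 ⟨Finset.mem_univ _, c, h, Or.inl rfl⟩)
      · exact hc (Finset.mem_filter.2 ⟨Finset.mem_univ _, a, h, Or.inr rfl⟩))
    (fun b b' h c hc => by
      have h3 := h c hc
      rcases c with c | c | c | ⟨a, c⟩ | c | c
      all_goals try exact h3
      simp only [reroute]
      split_ifs with hac
      · refine h _ ?_
        rcases hac with ⟨rfl, h⟩ | ⟨rfl, h⟩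
        · exact Finset.mem_filter.2 ⟨Finset.mem_univ _, c, h, Or.inr rfl⟩
        · exact Finset.mem_filter.2 ⟨Finset.mem_univ _, a, h, Or.inl rfl⟩
      · exact h3)
    (fun _ _ _ => rfl)
  exact ⟨Φ, fun v => by simpa using hΦ v⟩

theorem exists_encode_op (j : Fin n) (θ : Fin k → Fin k → ℂ) (hθ : ∀ h a, ‖θ h a‖ = 1) :
    ∃ Φ : QuantumOp (SubConfig (fun _ : Carrier n (Ancilla n) => k) (collected j)),
      ∀ v, applyOn (collected j) Φ (ketBra v) = ketBra fun b =>
        θ (b (phaseRecord j)) (b (Carrier.output j)) * v (encode j b) := by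
  refine exists_monomial_op (dim := fun _ : Carrier n (Ancilla n) => k)
    (collected j) 0 (encode j) (fun b => θ (b (phaseRecord j)) (b (Carrier.output j)))
    (encode_injective j) (fun _ => hθ _ _) (fun b c hc => ?_) (fun b b' h c hc => ?_)
    (fun b b' h => ?_)
  · rcases c with c | i | c | ⟨a, c⟩ | c | c
    all_goals try rfl
    · have : i ≠ j := by rintro rfl; simp [collected] at hc
      simp [encode, this]
    · have : a ≠ j := by rintro rfl; simp [collected] at hc
      simp [encode, this]
  · have h1 := h (Carrier.output j) (by simp [collected])
    have h2 := h (shiftRecord j) (by simp [collected])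
    have h3 := h c hc
    have h4 : ∀ l, b (share j l) = b' (share j l) := fun l => h _ (by simp [collected])
    rcases c with c | i | c | ⟨a, c⟩ | c | c
    all_goals simp only [encode, h1, h2, h3, h4]
  · rw [h (Carrier.output j) (by simp [collected]), h (phaseRecord j) (by simp [collected])]

/-- When `o` directs each pair one way, `IsCode` constrains only one of `share i l` and `share l i`;
the other is an idle partner for the exchange at the call point, in uniform superposition. -/
theorem exists_prepare_op (o : Fin n → Fin n → Prop) [DecidableRel o] :
    ∃ (Φ : QuantumOp (SubConfig (fun _ : Carrier n (Ancilla n) => k) (prepared n))) (κ : ℂ),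
      ∀ φ : Fin k → ℂ, applyOn (prepared n) Φ (ketBra fun b : Labels n k =>
          if ∀ c, c ≠ Carrier.input → b c = 0 then φ (b Carrier.input) else 0) =
        ketBra fun b : Labels n k =>
          if IsCode o b ∧ ∀ j, b (shiftRecord j) = 0 ∧ b (phaseRecord j) = 0
            then κ * φ (b Carrier.input) else 0 := by
  obtain ⟨Φ, κ, h⟩ := exists_reset_op (prepared n) (fun _ => 0) (IsCode (k := k) o)
    (fun b b' h => by
      have h1 : ∀ i, b (Carrier.output i) = b' (Carrier.output i) :=
        fun i => h _ (by simp [prepared])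
      have h2 : ∀ i l, b (share i l) = b' (share i l) := fun i l => h _ (by simp [prepared])
      have h3 : b half = b' half := h _ (by simp [prepared])
      simp only [IsCode, pairLabel, h1, h2, h3])
    (fun i => by simp [pairLabel])
  refine ⟨Φ, κ, fun φ => ?_⟩
  rw [h _ fun b hb c hc => ?_]
  · congr 1
    funext b
    rw [ite_and]
    congr 1
    have hin : glue (prepared n) b ((prepared n).restrict fun _ => (0 : Fin k)) Carrier.input =
        b Carrier.input := glue_apply_not_mem (by simp [prepared])
    rw [hin, mul_ite, mul_zero]
    congr 1
    refine propext ⟨fun h j => ⟨?_, ?_⟩, fun h c hc => ?_⟩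
    · rw [← h (shiftRecord j) (by simp), glue_apply_not_mem (by simp [prepared])]
    · rw [← h (phaseRecord j) (by simp), glue_apply_not_mem (by simp [prepared])]
    · by_cases hp : c ∈ prepared n
      · simp [hp]
      · rw [glue_apply_not_mem hp]
        simp only [prepared, Finset.mem_filter, Finset.mem_univ, true_and, not_and, not_forall,
          not_not] at hp
        obtain ⟨j, hj⟩ := hp hc
        by_cases hs : c = shiftRecord j
        · exact hs ▸ (h j).1
        · exact hj hs ▸ (h j).2
  · by_contra hne
    simp only [prepared, Finset.mem_filter, Finset.mem_univ, true_and] at hc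
    refine hb (if_neg fun hall => hne (hall c hc.1))

end Relay

/-! ### The code equations after routing and decoding. -/

namespace Relay

variable {n k : ℕ} [NeZero k]

/-- The state vector after teleportation into the code. -/
noncomputable def codeVector (o : Fin n → Fin n → Prop) [DecidableRel o] (κ : ℂ)
    (φ : Fin k → ℂ) (b : Labels n k) : ℂ :=
  if IsCode o b ∧ ∀ j, b (shiftRecord j) = 0 ∧ b (phaseRecord j) = 0
    then κ * φ (b Carrier.input) else 0

/-- The equation of `j` says that the register now holds the teleported label. In every other
equation that label occurs once on each side, through the pair shared with `j` and through the
encoded sum, and cancels; this decouples the register from the rest. -/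
theorem isCode_reroute_encode_iff (o : Fin n → Fin n → Prop) [DecidableRel o]
    (ho : ∀ i l, i ≠ l → (o i l ↔ ¬ o l i)) (j : Fin n) (b : Labels n k) (a : Fin k)
    (hb : b (shiftRecord j) = b half) :
    (∀ i, reroute o j (encode j b) (Carrier.output i) +
      ∑ l ∈ Finset.univ.erase i, pairLabel o (reroute o j (encode j b)) i l = b half + a) ↔
    a = b (Carrier.output j) ∧ ∀ i, i ≠ j → b (Carrier.output i) +
      ∑ l ∈ Finset.univ.erase i, (if l = j then b (share j i) + b half else pairLabel o b i l) =
        b half := by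
  -- All pair labels of `j` are now in `share j l`: exchanged into it if `j` routes the pair, there
  -- by default if `l` does.
  have hstar : ∀ l, l ≠ j → pairLabel o (reroute o j (encode j b)) j l =
      b (share j l) + (b (Carrier.output j) + b half) := by
    intro l hl
    by_cases h : o j l
    · simp [pairLabel, reroute, encode, h, hb]
    · simp [pairLabel, reroute, encode, h, hb, hl]
  have hstar' : ∀ i, i ≠ j → pairLabel o (reroute o j (encode j b)) i j =
      b (share j i) + (b (Carrier.output j) + b half) := by
    intro i hi
    by_cases h : o i j
    · simp [pairLabel, reroute, encode, h, hb, hi, (ho i j hi).1 h]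
    · simp [pairLabel, reroute, encode, h, hb, (ho j i hi.symm).2 h]
  have hoff : ∀ i l, i ≠ j → l ≠ j → pairLabel o (reroute o j (encode j b)) i l =
      pairLabel o b i l := by
    intro i l hi hl
    simp [pairLabel, reroute, encode, hi, hl]
  have hj : reroute o j (encode j b) (Carrier.output j) +
      ∑ l ∈ Finset.univ.erase j, pairLabel o (reroute o j (encode j b)) j l =
        b half + b (Carrier.output j) := by
    rw [Finset.sum_congr rfl fun l hl => hstar l (Finset.ne_of_mem_erase hl)]
    simp only [reroute, encode, if_true, hb, sub_add_cancel]
    rw [add_comm]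
  have hne : ∀ i, i ≠ j → reroute o j (encode j b) (Carrier.output i) +
      ∑ l ∈ Finset.univ.erase i, pairLabel o (reroute o j (encode j b)) i l =
      (b (Carrier.output i) + ∑ l ∈ Finset.univ.erase i,
        (if l = j then b (share j i) + b half else pairLabel o b i l)) +
        b (Carrier.output j) := by
    intro i hi
    have hji : j ∈ Finset.univ.erase i := Finset.mem_erase.2 ⟨hi.symm, Finset.mem_univ _⟩
    rw [← Finset.add_sum_erase _ _ hji, ← Finset.add_sum_erase _ _ hji, hstar' i hi, if_pos rfl,
      Finset.sum_congr rfl fun l hl => hoff i l hi (Finset.ne_of_mem_erase hl),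
      Finset.sum_congr rfl fun l hl => if_neg (Finset.ne_of_mem_erase hl)]
    simp only [reroute, encode, if_neg hi]
    abel
  constructor
  · intro h
    have ha : a = b (Carrier.output j) := (add_left_cancel (hj.symm.trans (h j))).symm
    refine ⟨ha, fun i hi => ?_⟩
    have := h i
    rw [hne i hi, ha, add_left_inj] at this
    exact this
  · rintro ⟨rfl, h⟩ i
    by_cases hi : i = j
    · exact hi ▸ hj
    · rw [hne i hi, h i hi]

/-- At the end, the register at the `j`-th reveal point is in the unknown state. -/
theorem exists_product_form (o : Fin n → Fin n → Prop) [DecidableRel o]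
    (ho : ∀ i l, i ≠ l → (o i l ↔ ¬ o l i)) (j : Fin n) (κ t : ℂ) (F : Matrix (Fin k) (Fin k) ℂ)
    (θ : Fin k → Fin k → ℂ) (hθ : ∀ h a, θ h a * F h a = t) (φ : Fin k → ℂ) :
    ∃ w : Labels n k → ℂ, (∀ b a, w (Function.update b (Carrier.output j) a) = w b) ∧
      ∀ b, θ (b (phaseRecord j)) (b (Carrier.output j)) *
        (∑ a, F (subRecords (reroute o j (encode j b)) Carrier.input) a *
          codeVector o κ φ (addInput
            (Function.update (subRecords (reroute o j (encode j b))) Carrier.input a))) =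
        φ (b (Carrier.output j)) * w b := by
  classical
  -- The factor `w` keeps the constraints that do not mention the `j`-th register.
  refine ⟨fun b => if (∀ i, b (shiftRecord i) = b half ∧ b (phaseRecord i) = b Carrier.input) ∧
      ∀ i, i ≠ j → b (Carrier.output i) + ∑ l ∈ Finset.univ.erase i,
        (if l = j then b (share j i) + b half else pairLabel o b i l) = b half
      then κ * t else 0, fun b a => ?_, fun b => ?_⟩
  · simp only [pairLabel]
    congr 1
    refine propext (and_congr ?_ (forall_congr' fun i => imp_congr_right fun hi => ?_))
    · simp
    · rw [Function.update_of_ne (a := Carrier.output i) (by simpa using hi)]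
      simp
  · set e := reroute o j (encode j b) with he
    have hin : subRecords e Carrier.input = b Carrier.input := rfl
    have hterm : ∀ a, codeVector o κ φ (addInput (Function.update (subRecords e)
        Carrier.input a)) =
        if (∀ i, b (shiftRecord i) = b half ∧ b (phaseRecord i) = b Carrier.input) ∧
          (∀ i, e (Carrier.output i) + ∑ l ∈ Finset.univ.erase i, pairLabel o e i l = b half + a)
        then κ * φ a else 0 := by
      intro a
      have h1 : addInput (Function.update (subRecords e) Carrier.input a) Carrier.input = a := by
        simp [addInput]
      have h2 : ∀ i, addInput (Function.update (subRecords e) Carrier.input a) (shiftRecord i) =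
          b (shiftRecord i) - b half := fun i => by
        simp [addInput, subRecords, he, reroute, encode]
      have h3 : ∀ i, addInput (Function.update (subRecords e) Carrier.input a) (phaseRecord i) =
          b (phaseRecord i) - b Carrier.input := fun i => by
        simp [addInput, subRecords, he, reroute, encode]
      have h4 : addInput (Function.update (subRecords e) Carrier.input a) half =
          b half + a := by
        simp [addInput, subRecords, he, reroute, encode]
      have h5 : ∀ i, addInput (Function.update (subRecords e) Carrier.input a)
          (Carrier.output i) = e (Carrier.output i) := fun i => by
        simp [addInput, subRecords]
      have h6 : ∀ i l, addInput (Function.update (subRecords e) Carrier.input a)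
          (share i l) = e (share i l) := fun i l => by
        simp [addInput, subRecords]
      simp only [codeVector, IsCode, pairLabel, h1, h2, h3, h4, h5, h6, sub_eq_zero]
      congr 1
      exact propext and_comm
    simp only [hterm, hin]
    by_cases hrec : ∀ i, b (shiftRecord i) = b half ∧ b (phaseRecord i) = b Carrier.input
    · simp only [isCode_reroute_encode_iff o ho j b _ (hrec j).1, he]
      -- The Fourier sum collapses to the label in the register, and the phase record equals the
      -- outcome, so `hθ` turns the phase into the constant `t`.
      rw [Finset.sum_eq_single (b (Carrier.output j)), (hrec j).2]
      · simp only [true_and, mul_ite, mul_zero]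
        split_ifs
        · rw [← hθ (b Carrier.input) (b (Carrier.output j))]
          ring
        · rfl
      · intro a _ ha
        simp [ha]
      · simp
    · simp [hrec]

end Relay

/-- With a single call, the steps at all call points, and likewise at all reveal points, reduce to
the one of the called index. -/
theorem SummoningTask.run_map_of_idle {d n : ℕ} (T : SummoningTask d n) {C α : Type} [Fintype C]
    [DecidableEq C] {dim : C → ℕ} (J : Set (Fin n)) (f : α → Step d n dim) (l : List α)
    (hl : l.Nodup) (j : α) (hj : j ∈ l)
    (hidle : ∀ i, i ≠ j → ∀ v, T.run J [f i] (ketBra v) = ketBra v)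
    (v v' : Config dim → ℂ) (hv : T.run J [f j] (ketBra v) = ketBra v') :
    T.run J (l.map f) (ketBra v) = ketBra v' := by
  have hall : ∀ (l : List α), j ∉ l → ∀ v, T.run J (l.map f) (ketBra v) = ketBra v := by
    intro l
    induction l with
    | nil => intro _ _; rfl
    | cons i l ih =>
      intro hj v
      rw [List.mem_cons, not_or] at hj
      rw [List.map_cons, ← List.singleton_append, T.run_append, hidle i (Ne.symm hj.1), ih hj.2]
  obtain ⟨l₁, l₂, rfl⟩ := List.append_of_mem hj
  rw [List.nodup_append] at hl
  obtain ⟨-, h2, h3⟩ := hl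
  rw [List.map_append, T.run_append, hall l₁ fun h => h3 j h j (by simp) rfl, List.map_cons,
    ← List.singleton_append, T.run_append, hv, hall l₂ (List.nodup_cons.1 h2).1]

/-! ### The protocol in spacetime: routing relation, schedule and causality. -/

namespace Relay

variable {d n : ℕ}

/-- The call point of `i` routes the share of the pair `i`, `l`. -/
def Routes (T : SummoningTask d n) (i l : Fin n) : Prop :=
  i ≠ l ∧ T.reveal l ∈ futureCone (T.call i) ∧ (T.reveal i ∉ futureCone (T.call l) ∨ i < l)

/-- By `hT` some call point of the pair qualifies; if both do, the order of the indices breaks the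
tie. -/
theorem routes_iff_not {T : SummoningTask d n}
    (hT : ∀ i j, T.reveal j ∈ futureCone (T.call i) ∨ T.reveal i ∈ futureCone (T.call j))
    (i l : Fin n) (h : i ≠ l) : Routes T i l ↔ ¬ Routes T l i := by
  have h1 := hT i l
  have h2 : ¬ i < l ↔ l < i := by
    rw [not_lt]
    exact ⟨fun h' => lt_of_le_of_ne h' h.symm, le_of_lt⟩
  have h3 : i < l → ¬ l < i := fun h => not_lt_of_gt h
  unfold Routes
  tauto

/-- The steps at the start point, the call points and the reveal points, after a step in the common
past of all these points, transmit the unknown state to the reveal point of the call. -/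
theorem exists_steps (T : SummoningTask d n) (k : ℕ) [NeZero k]
    (hstart : ∀ j, T.reveal j ∈ futureCone T.start)
    (hT : ∀ i j, T.reveal j ∈ futureCone (T.call i) ∨ T.reveal i ∈ futureCone (T.call j))
    (dim : Carrier n (Ancilla n) → ℕ) (hdim : ∀ c, dim c = k) (ready : Config dim)
    (hready : ∀ c, (ready c : ℕ) = 0) :
    ∃ steps : List (Step d n dim),
      (steps.Pairwise fun a b =>
        (a.carriers ∩ b.carriers).Nonempty → b.point ∈ futureCone a.point) ∧
      (∀ a ∈ steps, Carrier.input ∈ a.carriers → a.point ∈ futureCone T.start) ∧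
      (∀ a ∈ steps, ∀ j, Carrier.output j ∈ a.carriers → T.reveal j ∈ futureCone a.point) ∧
      ∀ (j : Fin n) (φ : Fin k → ℂ), ∑ a, ‖φ a‖ ^ 2 = 1 →
        reducedState (Carrier.output j) (T.run {j} steps (ketBra fun b =>
          if ∀ c, c ≠ Carrier.input → b c = ready c
            then φ (Fin.cast (hdim _) (b Carrier.input)) else 0)) =
        (ketBra φ).submatrix (Fin.cast (hdim _)) (Fin.cast (hdim _)) := by
  classical
  -- `Carrier.dim` is constant only after a case split, so a general `dim` is replaced by the
  -- constant function here to avoid casts.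
  obtain rfl : dim = fun _ => k := funext hdim
  obtain rfl : ready = fun _ => 0 := funext fun c => Fin.ext (by simpa using hready c)
  set o := Routes T with ho
  have hor := routes_iff_not hT
  obtain ⟨p, hp⟩ := exists_common_past (insert T.start
    (Finset.univ.image T.call ∪ Finset.univ.image T.reveal))
  have hps : T.start ∈ futureCone p := hp _ (by simp)
  have hpy : ∀ i, T.call i ∈ futureCone p := fun i => hp _ (by simp)
  have hpz : ∀ i, T.reveal i ∈ futureCone p := fun i => hp _ (by simp)
  obtain ⟨F, hF, hFn⟩ := exists_flat_unitary k
  -- Entries of `F` have absolute value `1 / √k`; the factor `√k` makes the phase corrections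
  -- unimodular.
  set s : ℂ := ((Real.sqrt k : ℝ) : ℂ) with hs
  have hk : (0 : ℝ) < k := Nat.cast_pos.2 (NeZero.pos k)
  have hθ : ∀ h a, ‖s * star (F h a)‖ = 1 := fun h a => by
    have hFa : ‖F h a‖ = (Real.sqrt k)⁻¹ := by
      rw [← Real.sqrt_inv, ← hFn h a, Real.sqrt_sq (norm_nonneg _)]
    rw [norm_mul, norm_star, hFa, hs, Complex.norm_real, Real.norm_eq_abs,
      abs_of_nonneg (Real.sqrt_nonneg _), mul_inv_cancel₀ (Real.sqrt_pos.2 hk).ne']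
  have hθF : ∀ h a, s * star (F h a) * F h a = s * ((k : ℝ)⁻¹ : ℝ) := fun h a => by
    rw [mul_assoc, Complex.star_def, Complex.conj_mul', ← hFn h a]
    push_cast
    rfl
  obtain ⟨Φ₀, κ, hΦ₀⟩ := exists_prepare_op (k := k) o
  obtain ⟨Φ₁, hΦ₁⟩ := exists_addInput_op (n := n) (k := k)
  obtain ⟨Φ₂, hΦ₂⟩ := exists_single_carrier_op (Carrier.input : Carrier n (Ancilla n)) F hF
  obtain ⟨Φ₃, hΦ₃⟩ := exists_subRecords_op (n := n) (k := k)
  choose Φ₄ hΦ₄ using exists_reroute_op (k := k) o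
  choose Φ₅ hΦ₅ using fun j : Fin n => exists_encode_op j (fun h a => s * star (F h a)) hθ
  choose Ψ hΨ using fun S : Finset (Carrier n (Ancilla n)) =>
    exists_idle_op (dim := fun _ => k) S
  set start : List (Step d n fun _ : Carrier n (Ancilla n) => k) :=
    [⟨T.start, {Carrier.input, half}, fun _ => Φ₁⟩, ⟨T.start, {Carrier.input}, fun _ => Φ₂⟩,
      ⟨T.start, recorded n, fun _ => Φ₃⟩] with hstartl
  set prep : Step d n fun _ : Carrier n (Ancilla n) => k := ⟨p, prepared n, fun _ => Φ₀⟩ with hprep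
  set Y : Fin n → Step d n fun _ : Carrier n (Ancilla n) => k := fun i =>
    ⟨T.call i, routed o i, fun J => if i ∈ J then Φ₄ i else Ψ _⟩ with hY
  set Z : Fin n → Step d n fun _ : Carrier n (Ancilla n) => k := fun i =>
    ⟨T.reveal i, collected i, fun J => if i ∈ J then Φ₅ i else Ψ _⟩ with hZ
  have hstart_mem : ∀ a ∈ start, a.point = T.start ∧ a.carriers ⊆ recorded n := by
    intro a ha
    simp only [hstartl, List.mem_cons, List.not_mem_nil, or_false] at ha
    rcases ha with rfl | rfl | rfl <;> refine ⟨rfl, ?_⟩ <;> intro c hc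
    · simp only [Finset.mem_insert, Finset.mem_singleton] at hc
      rcases hc with rfl | rfl <;> simp [recorded]
    · simp only [Finset.mem_singleton] at hc
      simp [recorded, hc]
    · exact hc
  have hmem_routed : ∀ i c, c ∈ routed o i ↔ ∃ l, o i l ∧ (c = share i l ∨ c = share l i) :=
    fun i c => by simp [routed]
  have hmem_collected : ∀ (i : Fin n) c, c ∈ collected i ↔ c = Carrier.output i ∨
      c = shiftRecord i ∨ c = phaseRecord i ∨ ∃ l, c = share i l := fun i c => by simp [collected]
  refine ⟨prep :: (start ++ ((List.finRange n).map Y ++ (List.finRange n).map Z)),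
    ?_, ?_, ?_, ?_⟩
  · simp only [List.pairwise_cons, List.pairwise_append, List.pairwise_map, List.mem_append,
      List.mem_map]
    refine ⟨?_, ?_, ⟨?_, ?_, ?_⟩, ?_⟩
    · rintro b (hb | ⟨i, -, rfl⟩ | ⟨i, -, rfl⟩) -
      · rw [(hstart_mem b hb).1]; exact hps
      · exact hpy i
      · exact hpz i
    · refine List.pairwise_of_forall_mem_list fun a ha b hb _ => ?_
      rw [(hstart_mem a ha).1, (hstart_mem b hb).1]
      exact self_mem_futureCone _
    -- A share used at two call points would belong to a pair routed from both ends.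
    · refine (List.nodup_finRange n).imp fun {i j} hij hne => ?_
      obtain ⟨c, hc⟩ := hne
      obtain ⟨hi, hj⟩ := Finset.mem_inter.1 hc
      obtain ⟨l, hl, h⟩ := (hmem_routed i c).1 hi
      obtain ⟨l', hl', h'⟩ := (hmem_routed j c).1 hj
      exfalso
      rcases h with rfl | rfl <;> simp only [Sum.inr.injEq, Sum.inl.injEq, Prod.mk.injEq] at h' <;>
        rcases h' with ⟨rfl, rfl⟩ | ⟨rfl, rfl⟩
      · exact hij rfl
      · exact (hor _ _ hij).1 hl hl'
      · exact (hor _ _ hij).1 hl hl'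
      · exact hij rfl
    · refine (List.nodup_finRange n).imp fun {i j} hij hne => ?_
      obtain ⟨c, hc⟩ := hne
      obtain ⟨hi, hj⟩ := Finset.mem_inter.1 hc
      refine absurd ?_ hij
      rcases (hmem_collected i c).1 hi with rfl | rfl | rfl | ⟨l, rfl⟩ <;>
        simpa using (hmem_collected j _).1 hj
    -- From the call point of `i` a share travels to the `i`-th reveal point or to that of its
    -- partner `l`; the second is possible by `Routes T i l`.
    · rintro a ⟨i, -, rfl⟩ b ⟨j, -, rfl⟩ ⟨c, hc⟩
      obtain ⟨hi, hj⟩ := Finset.mem_inter.1 hc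
      obtain ⟨l, hl, rfl | rfl⟩ := (hmem_routed i c).1 hi
      · obtain rfl : i = j := by simpa using (hmem_collected j _).1 hj
        exact T.reveal_mem i
      · obtain rfl : l = j := by simpa using (hmem_collected j _).1 hj
        exact hl.2.1
    -- Call points may lie outside the future of the start point: thanks to teleportation, the steps
    -- there share no carrier with those at the start.
    · rintro a ha b (⟨i, -, rfl⟩ | ⟨i, -, rfl⟩) hne
      · exfalso
        obtain ⟨c, hc⟩ := hne
        obtain ⟨ha', hi⟩ := Finset.mem_inter.1 hc
        obtain ⟨l, hl, rfl | rfl⟩ := (hmem_routed i c).1 hi <;>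
          simpa [recorded] using (hstart_mem a ha).2 ha'
      · rw [(hstart_mem a ha).1]
        exact hstart i
  · simp only [List.mem_cons, List.mem_append, List.mem_map]
    rintro a (rfl | ha | ⟨i, -, rfl⟩ | ⟨i, -, rfl⟩) hin
    · simp [hprep, prepared] at hin
    · rw [(hstart_mem a ha).1]
      exact self_mem_futureCone _
    · simp [hY, routed] at hin
    · simp [hZ, collected] at hin
  · simp only [List.mem_cons, List.mem_append, List.mem_map]
    rintro a (rfl | ha | ⟨i, -, rfl⟩ | ⟨i, -, rfl⟩) j hj
    · exact hpz j
    · rw [(hstart_mem a ha).1]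
      exact hstart j
    · simp [hY, routed] at hj
    · obtain rfl : j = i := by simpa [hZ, collected] using hj
      exact self_mem_futureCone _
  · intro j φ hφ
    obtain ⟨w, hw, hprod⟩ := exists_product_form o hor j κ _ F _ hθF φ
    have hheardY : ∀ i, i ∈ T.heard {j} (T.call i) ↔ i = j := fun i => by
      simp [SummoningTask.heard, self_mem_futureCone]
    have hheardZ : ∀ i, i ∈ T.heard {j} (T.reveal i) ↔ i = j := fun i => by
      simp [SummoningTask.heard, T.reveal_mem]
    have hrunY : ∀ v, T.run {j} ((List.finRange n).map Y) (ketBra v) =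
        ketBra fun b => v (reroute o j b) := fun v => by
      refine T.run_map_of_idle _ Y _ (List.nodup_finRange n) j (List.mem_finRange j)
        (fun i hi v => ?_) _ _ ?_
      · simp only [T.run_singleton, hY, hheardY, if_neg hi, hΨ]
      · simp only [T.run_singleton, hY, hheardY, if_true, hΦ₄]
    have hrunZ : ∀ v, T.run {j} ((List.finRange n).map Z) (ketBra v) =
        ketBra fun b => s * star (F (b (phaseRecord j)) (b (Carrier.output j))) *
          v (encode j b) := fun v => by
      refine T.run_map_of_idle _ Z _ (List.nodup_finRange n) j (List.mem_finRange j)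
        (fun i hi v => ?_) _ _ ?_
      · simp only [T.run_singleton, hZ, hheardZ, if_neg hi, hΨ]
      · simp only [T.run_singleton, hZ, hheardZ, if_true, hΦ₅]
    have hrun : T.run {j} (prep :: (start ++ ((List.finRange n).map Y ++ (List.finRange n).map Z)))
        (ketBra fun b : Labels n k => if ∀ c, c ≠ Carrier.input → b c = 0
          then φ (b Carrier.input) else 0) =
        ketBra fun b => φ (b (Carrier.output j)) * w b := by
      have hprep_run : T.run {j} [prep] (ketBra fun b : Labels n k =>
          if ∀ c, c ≠ Carrier.input → b c = 0 then φ (b Carrier.input) else 0) =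
          ketBra (codeVector o κ φ) := by
        rw [T.run_singleton]
        convert hΦ₀ φ using 5
        simp only [codeVector]
      have hstart_run : ∀ v, T.run {j} start (ketBra v) = ketBra fun b : Labels n k =>
          ∑ a, F (subRecords b Carrier.input) a *
            v (addInput (Function.update (subRecords b) Carrier.input a)) := fun v => by
        simp only [hstartl, SummoningTask.run, List.foldl_cons, List.foldl_nil, hΦ₁, hΦ₂, hΦ₃]
      rw [← List.singleton_append, T.run_append, T.run_append, T.run_append, hprep_run,
        hstart_run, hrunY, hrunZ]
      congr 1
      funext b
      exact hprod b
    have htrace := T.trace_run {j}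
      (prep :: (start ++ ((List.finRange n).map Y ++ (List.finRange n).map Z)))
      (ketBra fun b : Labels n k => if ∀ c, c ≠ Carrier.input → b c = 0
        then φ (b Carrier.input) else 0)
    rw [hrun, trace_ketBra_initial Carrier.input φ (fun _ => 0) hφ] at htrace
    have hfinal := reducedState_of_product (Carrier.output j) φ _ w (fun _ => rfl) hw hφ htrace 0
    rw [← hrun] at hfinal
    exact hfinal

end Relay

theorem SummoningTask.isPossible_of_related {d n k : ℕ} (T : SummoningTask d n) (hk : k ≠ 0)
    (hstart : ∀ j, T.reveal j ∈ futureCone T.start)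
    (hT : ∀ i j, T.reveal j ∈ futureCone (T.call i) ∨ T.reveal i ∈ futureCone (T.call j)) :
    T.IsPossible k := by
  have : NeZero k := ⟨hk⟩
  have hdim : ∀ c : Carrier n (Relay.Ancilla n), Carrier.dim k (fun _ => k) c = k := by
    rintro (c | c | c) <;> rfl
  obtain ⟨steps, h1, h2, h3, h4⟩ := Relay.exists_steps T k hstart hT
    (Carrier.dim k fun _ => k) hdim (fun c => Fin.cast (hdim c).symm 0) (fun c => by simp)
  exact ⟨{  Aux := Relay.Ancilla n
            auxDim := fun _ => k
            ready := fun c => Fin.cast (hdim c).symm 0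
            steps := steps
            steps_causal := h1
            input_causal := h2
            output_causal := h3 }, fun j φ hφ => h4 j φ hφ⟩

end Summoning

open Summoning
theorem theorem1 (d n k : ℕ) (hk : 2 ≤ k) (T : SummoningTask d n) :
    T.IsPossible k ↔
      (∀ j : Fin n, T.reveal j ∈ futureCone T.start) ∧
        ∀ i j : Fin n, CausallyRelated (T.diamond i) (T.diamond j) := by
  simp only [T.causallyRelated_iff]
  constructor
  · rintro ⟨P, hP⟩
    exact ⟨hP.reveal_mem_futureCone_start hk, hP.reveal_mem_futureCone_call hk⟩
  · rintro ⟨hstart, hT⟩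
    exact T.isPossible_of_related (by omega) hstart hT
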